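/- Let $a:\mathbb R\to(0,\infty)$ be measurable and locally bounded (from above), with $\int_{\mathbb R}a(x)^{-1}\,dx=1$, and let $\mu(dx)=a(x)^{-1}\,dx$. Let $B$ be a one-dimensional Brownian motion, $A_t=\int_0^t a(B_s)^{-1}\,ds$, $\tau_t=\inf\{s>0:A_s>t\}$, and consider the time-changed Brownian motion $Y_t=B_{\tau_t}$, whose Dirichlet form on $L^2(\mathbb R;\mu)$ is $$\mathcal E(f,f)=\frac12\int_{\mathbb R}f'(x)^2\,dx,\qquad \mathcal F^\mu=\{f\in L^2(\mathbb R;\mu):\ \mathcal E(f,f)<\infty\},$$ where $f'$ is the a.e. derivative of the locally absolutely continuous version of $f$, and $\mathcal E(f,f)=\infty$ if there is no such version. Write $\mu(f)=\int f\,d\mu$ and $B(0,s)=(-s,s)$. For $r>0$ put $$\Phi(r)=\inf_{|x|\ge r}\frac{a(x)}{(1+|x|)^2},\quad \Phi_0(r)=\inf_{|x|\le r}\frac{a(x)}{(1+|x|)^2},\quad K(r)=\sup_{|x|\le r}\frac1{a(x)},\quad k(r)=\inf_{|x|\le r}\frac1{a(x)},\quad K_0(r)=\frac{K(r)^{3/2}}{k(r)^2},$$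 with values in $[0,\infty]$; the last three are defined by the same formulas for $r=0$, and $K_0(\infty)=\infty$. Let $\Phi^{-1}(t)=\inf\{s>0:\Phi(s)\ge t\}$, with $\inf\emptyset=\infty$. Then the following hold. (i) There is a constant $C>0$ such that the Poincaré inequality $$\mu\big((f-\mu(f))^2\big)\le C\,\mathcal E(f,f),\qquad f\in\mathcal F^\mu,$$ holds if and only if $$\limsup_{|x|\to\infty}\ |x|\int_{\{|s|\ge|x|\}}\frac{ds}{a(s)}<\infty.\tag{1}$$ In particular, if $\lim_{r\to\infty}\Phi(r)>0$, then (1) is satisfied. (ii) There is a function $\beta:(0,\infty)\to(0,\infty)$ such that the super Poincaré inequality $$\mu(f^2)\le r\,\mathcal E(f,f)+\beta(r)\,\mu(|f|)^2,\qquad r>0,\ f\in\mathcal F^\mu,\tag{2}$$ holds if and only if $$\limsup_{|x|\to\infty}\ |x|\int_{\{|s|\ge|x|\}}\frac{ds}{a(s)}=0.\tag{3}$$ Moreover, in this case there are constants $C_1,C_2>0$ such that (2) holds with $$\beta(r)=C_1\Big(1+r^{-1/2}K_0\big(\Phi^{-1}(C_2/r)\big)\Big)$$ (an inequality that is void at those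 $r$ where this value is $\infty$). In particular, if $\lim_{r\to\infty}\Phi(r)=\infty$, then (3) is satisfied. (iii) If $\lim_{r\to\infty}\Phi_0(r)=0$, then there is a constant $C>0$, independent of $r$, such that the weak Poincaré inequality $$\mu(f^2)\le\alpha(r)\,\mathcal E(f,f)+r\,\|f\|_\infty^2,\qquad r>0,\ f\in\mathcal F^\mu,\ \mu(f)=0,$$ holds with $$\alpha(r)=C\inf\Big\{\frac1{\Phi_0(s)}:\ s>0,\ \mu(B(0,s))\ge\frac1{1+r}\Big\}$$ (where $1/0=\infty$ and the inequality is void if $\alpha(r)=\infty$). -/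

import Mathlib

open MeasureTheory Filter Topology
open scoped ENNReal NNReal

namespace TimeChangedBM

noncomputable section

/-- The measure `μ(dx) = a(x)⁻¹ dx` on the real line. -/
def mu (a : ℝ → ℝ) : Measure ℝ :=
  volume.withDensity fun x => ENNReal.ofReal (a x)⁻¹

/-- `g` is locally absolutely continuous on `ℝ`. -/
def LocallyAC (g : ℝ → ℝ) : Prop :=
  ∀ b c : ℝ, AbsolutelyContinuousOnInterval g b c

/-- The energy `𝓔(f,f) = (1/2) ∫ f'(x)² dx`, with `f'` the a.e. derivative of the locally absolutely
continuous version of `f`; it is `∞` if `f` has no such version. The version is unique when it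
exists (see `energy_eq`), so the infimum is over at most one function. -/
def energy (f : ℝ → ℝ) : ℝ≥0∞ :=
  ⨅ (g : ℝ → ℝ) (_ : LocallyAC g ∧ f =ᵐ[volume] g), 2⁻¹ * ∫⁻ x, ‖deriv g x‖ₑ ^ 2

lemma LocallyAC.continuous {g : ℝ → ℝ} (hg : LocallyAC g) : Continuous g := by
  refine continuous_iff_continuousAt.2 fun x => ?_
  refine (hg (x - 1) (x + 1)).continuousOn.continuousAt ?_
  rw [Set.uIcc_of_le (by linarith)]
  exact Icc_mem_nhds (by linarith) (by linarith)

lemma energy_eq {f g : ℝ → ℝ} (hg : LocallyAC g) (hfg : f =ᵐ[volume] g) :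
    energy f = 2⁻¹ * ∫⁻ x, ‖deriv g x‖ₑ ^ 2 := by
  refine le_antisymm (iInf₂_le g ⟨hg, hfg⟩) (le_iInf₂ fun h hh => ?_)
  have : g = h := (hg.continuous.ae_eq_iff_eq volume hh.1.continuous).1 (hfg.symm.trans hh.2)
  rw [this]

/-- Membership in the domain `𝓕^μ = {f ∈ L²(μ) : 𝓔(f,f) < ∞}` of the Dirichlet form. -/
def InDomain (a f : ℝ → ℝ) : Prop :=
  MemLp f 2 (mu a) ∧ energy f < ∞

/-! The functions `Φ, Φ₀, K, k, K₀` take values in `[0,∞]`, and the radius is also allowed to be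
`∞`, so that infima, suprema and the inverse of `Φ` need no junk values. -/

/-- `Φ(r) = inf_{|x| ≥ r} a(x) / (1+|x|)²`. -/
def Phi (a : ℝ → ℝ) (r : ℝ≥0∞) : ℝ≥0∞ :=
  ⨅ (x : ℝ) (_ : r ≤ ‖x‖ₑ), ENNReal.ofReal (a x / (1 + |x|) ^ 2)

/-- `Φ₀(r) = inf_{|x| ≤ r} a(x) / (1+|x|)²`. -/
def Phi0 (a : ℝ → ℝ) (r : ℝ≥0∞) : ℝ≥0∞ :=
  ⨅ (x : ℝ) (_ : ‖x‖ₑ ≤ r), ENNReal.ofReal (a x / (1 + |x|) ^ 2)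

/-- `K(r) = sup_{|x| ≤ r} a(x)⁻¹`. -/
def bigK (a : ℝ → ℝ) (r : ℝ≥0∞) : ℝ≥0∞ :=
  ⨆ (x : ℝ) (_ : ‖x‖ₑ ≤ r), ENNReal.ofReal (a x)⁻¹

/-- `k(r) = inf_{|x| ≤ r} a(x)⁻¹`. -/
def smallK (a : ℝ → ℝ) (r : ℝ≥0∞) : ℝ≥0∞ :=
  ⨅ (x : ℝ) (_ : ‖x‖ₑ ≤ r), ENNReal.ofReal (a x)⁻¹

/-- `K₀(r) = K(r)^{3/2} / k(r)²`. -/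
def K0 (a : ℝ → ℝ) (r : ℝ≥0∞) : ℝ≥0∞ :=
  bigK a r ^ (3 / 2 : ℝ) / smallK a r ^ 2

/-- The generalized inverse `Φ⁻¹(t) = inf {s : Φ(s) ≥ t}` of the nondecreasing function `Φ`; it is
`∞` if no finite `s` has `Φ(s) ≥ t`. -/
def PhiInv (a : ℝ → ℝ) (t : ℝ≥0∞) : ℝ≥0∞ :=
  sInf {s | t ≤ Phi a s}

/-- `limsup_{|x| → ∞} |x| ∫_{|s| ≥ |x|} ds / a(s)`. -/
def tailLimsup (a : ℝ → ℝ) : ℝ≥0∞ :=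
  limsup (fun x : ℝ => ‖x‖ₑ * ∫⁻ s in {s : ℝ | |x| ≤ |s|}, ENNReal.ofReal (a s)⁻¹) (cocompact ℝ)

/-- The Poincaré inequality `μ((f - μ(f))²) ≤ C 𝓔(f,f)` for all `f ∈ 𝓕^μ`. -/
def Poincare (a : ℝ → ℝ) (C : ℝ) : Prop :=
  ∀ f : ℝ → ℝ, InDomain a f →
    ∫⁻ x, ‖f x - ∫ y, f y ∂(mu a)‖ₑ ^ 2 ∂(mu a) ≤ ENNReal.ofReal C * energy f

/-- The super Poincaré inequality `μ(f²) ≤ r 𝓔(f,f) + β(r) μ(|f|)²` for all `r > 0`, `f ∈ 𝓕^μ`. -/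
def SuperPoincare (a : ℝ → ℝ) (β : ℝ → ℝ≥0∞) : Prop :=
  ∀ r : ℝ, 0 < r → ∀ f : ℝ → ℝ, InDomain a f →
    ∫⁻ x, ‖f x‖ₑ ^ 2 ∂(mu a) ≤
      ENNReal.ofReal r * energy f + β r * (∫⁻ x, ‖f x‖ₑ ∂(mu a)) ^ 2

/-- The weak Poincaré inequality `μ(f²) ≤ α(r) 𝓔(f,f) + r ‖f‖_∞²` for all `r > 0` and all
`f ∈ 𝓕^μ` with `μ(f) = 0`. -/
def WeakPoincare (a : ℝ → ℝ) (α : ℝ → ℝ≥0∞) : Prop :=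
  ∀ r : ℝ, 0 < r → ∀ f : ℝ → ℝ, InDomain a f → ∫ x, f x ∂(mu a) = 0 →
    ∫⁻ x, ‖f x‖ₑ ^ 2 ∂(mu a) ≤
      α r * energy f + ENNReal.ofReal r * eLpNorm f ∞ (mu a) ^ 2

/-- The rate `C₁ (1 + r^{-1/2} K₀(Φ⁻¹(C₂/r)))`. -/
def superRate (a : ℝ → ℝ) (C₁ C₂ r : ℝ) : ℝ≥0∞ :=
  ENNReal.ofReal C₁ *
    (1 + ENNReal.ofReal (r ^ (-(1 / 2) : ℝ)) * K0 a (PhiInv a (ENNReal.ofReal (C₂ / r))))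

/-- The rate `C inf {1/Φ₀(s) : s > 0, μ(B(0,s)) ≥ 1/(1+r)}`. -/
def weakRate (a : ℝ → ℝ) (C r : ℝ) : ℝ≥0∞ :=
  ENNReal.ofReal C *
    ⨅ (s : ℝ≥0) (_ : 0 < s ∧ ENNReal.ofReal (1 / (1 + r)) ≤ mu a (Metric.ball 0 s)), (Phi0 a s)⁻¹

end

end TimeChangedBM

namespace TimeChangedBM

/-! Everything rests on a weighted Hardy inequality (`hardy`). For `g` locally absolutely
continuous, `|g x - g 0|` is at most the integral of `|g'|` over `|t| ≤ |x|`. Cauchy–Schwarz with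
the weight `|t|^(-1/2)`, followed by Tonelli, bounds the square of the `L²(ν)` norm of that integral
by `8 B ∫ g'²`, where `B` dominates `|x| ν(|s| ≥ |x|)`. The variance is at most the mean square
distance to `g 0`, so a finite tail limsup gives the Poincaré inequality.

Conversely, `ramp x` has energy at most `x/2`, vanishes on `|t| ≤ x/2` and equals `x/2` on the tail.
Its support has small mass, so Cauchy–Schwarz lets its `L²` norm absorb its `L¹` norm. Hence `μ(f²)
≤ r 𝓔(f,f) + b μ(|f|)²` forces `tailLimsup a ≤ 4 r` (`tailLimsup_le_of_defective_poincare`). A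
Poincaré inequality has this form with `b = 1`; a super Poincaré inequality has it for every `r >
0`.

For super Poincaré the line is cut at `±R`. Outside, Hardy is applied to the restricted measure,
whose tail constant is small, and the value `g R` is added. Inside, `g` is compared with its
averages over windows of radius `ℓ`: a small `ℓ` makes the gradient term small, at the price of an
`L¹(dx)` norm, which `L¹(μ)` controls because `1/a` is bounded below on `[-R, R]`. The explicit rate
comes from `R = Φ⁻¹(C₂/r)` and `ℓ` of order `(r/K)^(1/2)`: then `K ℓ²` is of order `r`, and `K / (ℓ
k²)` is of order `r^(-1/2) K^(3/2) / k²`, whence `K0`.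

For weak Poincaré, Hardy is applied on a ball, where the density is at most `Φ₀(s)⁻¹ (1+|x|)⁻²`;
boundedness and zero mean take care of the complement (`lintegral_sq_le_of_mean_zero`). -/

/-! ### Cauchy–Schwarz and integrals of powers -/

/-- Cauchy–Schwarz inequality for a function whose square is dominated by a product. -/
lemma sq_lintegral_le_mul {α : Type*} [MeasurableSpace α] {ν : Measure α} {φ u p : α → ℝ≥0∞}
    (hu : AEMeasurable u ν) (hp : AEMeasurable p ν) (h : ∀ᵐ t ∂ν, φ t ^ 2 ≤ u t * p t) :
    (∫⁻ t, φ t ∂ν) ^ 2 ≤ (∫⁻ t, u t ∂ν) * ∫⁻ t, p t ∂ν := by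
  have half (y : ℝ≥0∞) : (y ^ (1 / 2 : ℝ)) ^ (2 : ℝ) = y := by
    rw [← ENNReal.rpow_mul]; norm_num
  have half' (y : ℝ≥0∞) : (y ^ (1 / 2 : ℝ)) ^ 2 = y := by
    rw [← ENNReal.rpow_natCast, ← ENNReal.rpow_mul]; norm_num
  have h1 : ∫⁻ t, φ t ∂ν ≤ ∫⁻ t, (fun t => u t ^ (1 / 2 : ℝ)) t * (p t ^ (1 / 2 : ℝ)) ∂ν := by
    refine lintegral_mono_ae (h.mono fun t ht => ?_)
    have h2 : (φ t ^ 2) ^ (1 / 2 : ℝ) ≤ (u t * p t) ^ (1 / 2 : ℝ) :=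
      ENNReal.rpow_le_rpow ht (by norm_num)
    rw [ENNReal.mul_rpow_of_nonneg _ _ (by norm_num), ← ENNReal.rpow_natCast,
      ← ENNReal.rpow_mul] at h2
    simpa using h2
  have h3 := h1.trans (ENNReal.lintegral_mul_le_Lp_mul_Lq ν Real.HolderConjugate.two_two
    (hu.pow_const (1 / 2 : ℝ)) (hp.pow_const (1 / 2 : ℝ)))
  simp only [half] at h3
  calc _ ≤ _ := pow_le_pow_left₀ (zero_le) h3 2
    _ = _ := by rw [mul_pow, half', half']

lemma LocallyAC.enorm_sub_le {g : ℝ → ℝ} (hg : LocallyAC g) {x y : ℝ} {S : Set ℝ}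
    (hS : Set.uIcc x y ⊆ S) : ‖g x - g y‖ₑ ≤ ∫⁻ t in S, ‖deriv g t‖ₑ := by
  rw [← (hg y x).integral_deriv_eq_sub]
  calc _ ≤ ∫⁻ t in Set.uIoc y x, ‖deriv g t‖ₑ := by
        rw [← ofReal_norm, intervalIntegral.norm_intervalIntegral_eq, ofReal_norm]
        exact enorm_integral_le_lintegral_enorm _
    _ ≤ _ := lintegral_mono_set ((Set.uIoc_subset_uIcc).trans (by rwa [Set.uIcc_comm]))

lemma measurable_enorm_deriv (g : ℝ → ℝ) : Measurable fun t => ‖deriv g t‖ₑ :=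
  (measurable_deriv g).enorm

lemma ennreal_add_sq_le (x y : ℝ≥0∞) : (x + y) ^ 2 ≤ 2 * x ^ 2 + 2 * y ^ 2 := by
  have h := ENNReal.rpow_add_le_mul_rpow_add_rpow x y (p := 2) (by norm_num)
  norm_num at h
  rwa [mul_add] at h

lemma lintegral_comp_abs {F : ℝ → ℝ≥0∞} : ∫⁻ t : ℝ, F |t| = 2 * ∫⁻ t in Set.Ioi 0, F t := by
  have h1 : ∫⁻ t in Set.Ioi (0 : ℝ), F |t| = ∫⁻ t in Set.Ioi 0, F t :=
    setLIntegral_congr_fun measurableSet_Ioi fun t ht => by rw [abs_of_pos ht]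
  have h2 : ∫⁻ t in Set.Iic (0 : ℝ), F |t| = ∫⁻ t in Set.Ioi 0, F t := by
    have := (Measure.measurePreserving_neg (volume : Measure ℝ)).setLIntegral_comp_preimage_emb
      (MeasurableEquiv.neg ℝ).measurableEmbedding (fun t => F |t|) (Set.Ici 0)
    simp only [abs_neg, Set.neg_preimage, Set.neg_Ici, neg_zero] at this
    rw [this, ← h1]
    exact setLIntegral_congr Ioi_ae_eq_Ici.symm
  rw [← lintegral_add_compl _ (measurableSet_Ioi (a := (0 : ℝ))), Set.compl_Ioi, h1, h2, two_mul]

lemma setLIntegral_comp_abs {F : ℝ → ℝ≥0∞} {S : Set ℝ} (hS : MeasurableSet S) :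
    ∫⁻ t in {t : ℝ | |t| ∈ S}, F |t| = 2 * ∫⁻ t in S ∩ Set.Ioi 0, F t := by
  have hS' : MeasurableSet {t : ℝ | |t| ∈ S} := measurable_norm hS
  rw [← lintegral_indicator hS', ← setLIntegral_indicator hS, ← lintegral_comp_abs]
  rfl

/-- The integral of `s ^ p` over `(c, x]`. -/
lemma lintegral_Ioc_rpow {p c x : ℝ} (hp : -1 < p) (hc : 0 ≤ c) (hx : c ≤ x) :
    ∫⁻ s in Set.Ioc c x, ENNReal.ofReal (s ^ p) =
      ENNReal.ofReal ((x ^ (p + 1) - c ^ (p + 1)) / (p + 1)) := by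
  rw [← integral_rpow (Or.inl hp), intervalIntegral.integral_of_le hx,
    ofReal_integral_eq_lintegral_ofReal]
  · exact ((intervalIntegrable_iff_integrableOn_Ioc_of_le hx).1
      (intervalIntegral.intervalIntegrable_rpow' hp))
  · exact (ae_restrict_mem measurableSet_Ioc).mono fun s hs =>
      Real.rpow_nonneg (hc.trans hs.1.le) _

lemma lintegral_Ioi_rpow {p c : ℝ} (hp : p < -1) (hc : 0 < c) :
    ∫⁻ s in Set.Ioi c, ENNReal.ofReal (s ^ p) = ENNReal.ofReal (-c ^ (p + 1) / (p + 1)) := by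
  rw [← integral_Ioi_rpow_of_lt hp hc, ofReal_integral_eq_lintegral_ofReal]
  · exact integrableOn_Ioi_rpow_of_lt hp hc
  · exact (ae_restrict_mem measurableSet_Ioi).mono fun s hs =>
      Real.rpow_nonneg (hc.trans hs).le _

lemma lintegral_abs_rpow_neg_half (x : ℝ) :
    ∫⁻ t in {t : ℝ | |t| ≤ |x|}, ENNReal.ofReal (|t| ^ (-(1 / 2) : ℝ)) =
      4 * ENNReal.ofReal (|x| ^ (1 / 2 : ℝ)) := by
  have := setLIntegral_comp_abs (F := fun t => ENNReal.ofReal (t ^ (-(1 / 2) : ℝ)))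
    (measurableSet_Iic (a := |x|))
  simp only [Set.mem_Iic] at this
  rw [this, Set.inter_comm, Set.Ioi_inter_Iic, lintegral_Ioc_rpow (by norm_num) le_rfl (abs_nonneg x)]
  have h (y : ℝ) : (4 : ℝ≥0∞) * ENNReal.ofReal y = 2 * ENNReal.ofReal (2 * y) := by
    rw [ENNReal.ofReal_mul (by norm_num), ← mul_assoc]; norm_num
  rw [h]
  congr 2
  norm_num
  ring

/-- The tail of the Cauchy-like density `(1 + |s|)⁻²`. -/
lemma lintegral_tail_inv_sq (x : ℝ) :
    ∫⁻ s in {s : ℝ | |x| ≤ |s|}, ENNReal.ofReal (((1 + |s|) ^ 2)⁻¹) =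
      2 * ENNReal.ofReal ((1 + |x|)⁻¹) := by
  have := setLIntegral_comp_abs (F := fun t => ENNReal.ofReal (((1 + t) ^ 2)⁻¹))
    (measurableSet_Ici (a := |x|))
  simp only [Set.mem_Ici] at this
  have h1 : (Set.Ici |x| ∩ Set.Ioi 0 : Set ℝ) =ᵐ[volume] Set.Ioi |x| := by
    have := (Ioi_ae_eq_Ici (μ := volume) (a := |x|)).symm.inter (ae_eq_refl (Set.Ioi (0 : ℝ)))
    rwa [Set.Ioi_inter_Ioi, sup_of_le_left (abs_nonneg x)] at this
  have hd : ∀ s ∈ Set.Ici |x|, HasDerivAt (fun s : ℝ => -(1 + s)⁻¹) (((1 + s) ^ 2)⁻¹) s := by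
    intro s hs
    have h0 : 1 + s ≠ 0 := by have := (abs_nonneg x).trans (Set.mem_Ici.1 hs); positivity
    have := (((hasDerivAt_id s).const_add 1).inv h0).neg
    convert! this using 1
    simp [neg_div]
  have hn : ∀ s ∈ Set.Ioi |x|, 0 ≤ ((1 + s) ^ 2)⁻¹ := fun s hs => by positivity
  have ht : Tendsto (fun s : ℝ => -(1 + s)⁻¹) atTop (𝓝 0) := by
    rw [← neg_zero]
    exact (tendsto_inv_atTop_zero.comp (tendsto_atTop_add_const_left _ _ tendsto_id)).neg
  rw [this, setLIntegral_congr h1, ← ofReal_integral_eq_lintegral_ofReal,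
    integral_Ioi_of_hasDerivAt_of_nonneg' hd hn ht]
  · simp
  · exact integrableOn_Ioi_deriv_of_nonneg' hd hn ht
  · exact (ae_restrict_mem measurableSet_Ioi).mono hn

/-! ### The weighted Hardy inequality -/

/-- If the tails of `ν` are `O(1/|x|)`, then so are the `|x|^{1/2}`-moments of its tails, up to the
corresponding change of the exponent. -/
lemma lintegral_tail_sqrt_le {ν : Measure ℝ} [SFinite ν] {B : ℝ≥0∞}
    (hB : ∀ x : ℝ, ‖x‖ₑ * ν {s : ℝ | |x| ≤ |s|} ≤ B) {t : ℝ} (ht : t ≠ 0) :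
    ENNReal.ofReal (|t| ^ (1 / 2 : ℝ)) *
      ∫⁻ x in {x : ℝ | |t| ≤ |x|}, ENNReal.ofReal (|x| ^ (1 / 2 : ℝ)) ∂ν ≤ 2 * B := by
  have ht0 : 0 < |t| := abs_pos.2 ht
  have hB' (s : ℝ) (hs : 0 < s) : ν {x : ℝ | s ≤ |x|} ≤ ENNReal.ofReal s⁻¹ * B := by
    have h := hB s
    rw [Real.enorm_eq_ofReal_abs, abs_of_pos hs] at h
    calc ν {x : ℝ | s ≤ |x|} = ENNReal.ofReal s⁻¹ * (ENNReal.ofReal s * ν {x : ℝ | s ≤ |x|}) := by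
          rw [← mul_assoc, ← ENNReal.ofReal_mul (by positivity), inv_mul_cancel₀ hs.ne']; simp
      _ ≤ _ := by gcongr
  have hmeas (s : ℝ) : MeasurableSet {x : ℝ | s ≤ |x|} := measurableSet_le measurable_const measurable_norm
  -- Layer cake: `|x|^(1/2) = |t|^(1/2) + ∫ ½ s^(-1/2) ds` over `(|t|, |x|]`, so that after a swap
  -- only tails of `ν` appear. Each of the two summands contributes one `B`.
  have h1 : ∫⁻ x in {x : ℝ | |t| ≤ |x|}, ENNReal.ofReal (|x| ^ (1 / 2 : ℝ)) ∂ν =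
      ENNReal.ofReal (|t| ^ (1 / 2 : ℝ)) * ν {x : ℝ | |t| ≤ |x|} +
      ∫⁻ x in {x : ℝ | |t| ≤ |x|}, (∫⁻ s in Set.Ioi |t|,
        {s : ℝ | s ≤ |x|}.indicator (fun s => ENNReal.ofReal (2⁻¹ * s ^ (-(1 / 2) : ℝ))) s) ∂ν := by
    rw [← setLIntegral_const, ← lintegral_add_left measurable_const]
    refine setLIntegral_congr_fun (hmeas _) fun x hx => ?_
    have hx' : |t| ≤ |x| := hx
    rw [show {s : ℝ | s ≤ |x|} = Set.Iic |x| from rfl, setLIntegral_indicator measurableSet_Iic,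
      Set.inter_comm, Set.Ioi_inter_Iic]
    simp_rw [ENNReal.ofReal_mul (p := (2⁻¹ : ℝ)) (by norm_num)]
    rw [lintegral_const_mul' _ _ ENNReal.ofReal_ne_top,
      lintegral_Ioc_rpow (by norm_num) ht0.le hx', ← ENNReal.ofReal_mul (by norm_num),
      ← ENNReal.ofReal_add (by positivity)]
    · norm_num; ring_nf
    · have : |t| ^ (-(1 / 2) + 1 : ℝ) ≤ |x| ^ (-(1 / 2) + 1 : ℝ) :=
        Real.rpow_le_rpow ht0.le hx' (by norm_num)
      have := sub_nonneg.2 this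
      positivity
  have h2 : ∫⁻ x in {x : ℝ | |t| ≤ |x|}, (∫⁻ s in Set.Ioi |t|,
        {s : ℝ | s ≤ |x|}.indicator (fun s => ENNReal.ofReal (2⁻¹ * s ^ (-(1 / 2) : ℝ))) s) ∂ν ≤
      ENNReal.ofReal (|t| ^ (-(1 / 2) : ℝ)) * B := by
    rw [lintegral_lintegral_swap]
    · calc _ ≤ ∫⁻ s in Set.Ioi |t|, ENNReal.ofReal (2⁻¹ * s ^ (-(3 / 2) : ℝ)) * B := by
            refine setLIntegral_mono' measurableSet_Ioi fun s hs => ?_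
            have hs0 : 0 < s := ht0.trans hs
            calc _ ≤ ∫⁻ x, {x : ℝ | s ≤ |x|}.indicator
                    (fun _ => ENNReal.ofReal (2⁻¹ * s ^ (-(1 / 2) : ℝ))) x ∂ν := by
                  refine (setLIntegral_le_lintegral _ _).trans_eq (lintegral_congr fun x => ?_)
                  simp [Set.indicator]
              _ = ENNReal.ofReal (2⁻¹ * s ^ (-(1 / 2) : ℝ)) * ν {x : ℝ | s ≤ |x|} :=
                  lintegral_indicator_const (hmeas s) _
              _ ≤ ENNReal.ofReal (2⁻¹ * s ^ (-(1 / 2) : ℝ)) * (ENNReal.ofReal s⁻¹ * B) := by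
                  gcongr; exact hB' s hs0
              _ = _ := by
                  rw [← mul_assoc, ← ENNReal.ofReal_mul (by positivity), mul_assoc,
                    ← Real.rpow_neg_one s, ← Real.rpow_add hs0]
                  norm_num
        _ = _ := by
            rw [lintegral_mul_const _ (by fun_prop)]
            simp_rw [ENNReal.ofReal_mul (p := (2⁻¹ : ℝ)) (by norm_num)]
            rw [lintegral_const_mul' _ _ ENNReal.ofReal_ne_top,
              lintegral_Ioi_rpow (by norm_num) ht0, ← ENNReal.ofReal_mul (by norm_num)]
            congr 2
            norm_num
            ring
    · refine Measurable.aemeasurable ?_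
      have : MeasurableSet {q : ℝ × ℝ | q.2 ≤ |q.1|} :=
        measurableSet_le measurable_snd measurable_fst.norm
      exact Measurable.indicator (f := fun q : ℝ × ℝ => ENNReal.ofReal (2⁻¹ * q.2 ^ (-(1 / 2) : ℝ)))
        (by fun_prop) this
  have hpow : |t| ^ (1 / 2 : ℝ) * |t| ^ (1 / 2 : ℝ) * |t|⁻¹ = 1 := by
    rw [← Real.rpow_neg_one, ← Real.rpow_add ht0, ← Real.rpow_add ht0]; norm_num
  have hpow' : |t| ^ (1 / 2 : ℝ) * |t| ^ (-(1 / 2) : ℝ) = 1 := by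
    rw [← Real.rpow_add ht0]; norm_num
  rw [h1, mul_add, two_mul]
  refine add_le_add ?_ ?_
  · calc _ ≤ ENNReal.ofReal (|t| ^ (1 / 2 : ℝ)) *
          (ENNReal.ofReal (|t| ^ (1 / 2 : ℝ)) * (ENNReal.ofReal |t|⁻¹ * B)) := by
          gcongr; exact hB' _ ht0
      _ = B := by
          rw [← mul_assoc, ← mul_assoc, ← ENNReal.ofReal_mul (by positivity),
            ← ENNReal.ofReal_mul (by positivity), hpow]; simp
  · calc _ ≤ ENNReal.ofReal (|t| ^ (1 / 2 : ℝ)) * (ENNReal.ofReal (|t| ^ (-(1 / 2) : ℝ)) * B) := by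
          gcongr
      _ = B := by
          rw [← mul_assoc, ← ENNReal.ofReal_mul (by positivity), hpow']; simp

/-- A weighted Hardy inequality: if the tails of `ν` are at most `B / |x|`, the operator
`φ ↦ ∫_{|t| ≤ |x|} φ` is bounded from `L²(dx)` to `L²(ν)` with squared norm at most `8 B`. -/
lemma hardy {ν : Measure ℝ} [SFinite ν] {B : ℝ≥0∞}
    (hB : ∀ x : ℝ, ‖x‖ₑ * ν {s : ℝ | |x| ≤ |s|} ≤ B) {φ : ℝ → ℝ≥0∞} (hφ : Measurable φ) :
    ∫⁻ x, (∫⁻ t in {t : ℝ | |t| ≤ |x|}, φ t) ^ 2 ∂ν ≤ 8 * B * ∫⁻ t, φ t ^ 2 := by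
  have hmeas (x : ℝ) : MeasurableSet {t : ℝ | |t| ≤ |x|} := measurableSet_le measurable_norm measurable_const
  have hmeas' (x : ℝ) : MeasurableSet {t : ℝ | |x| ≤ |t|} := measurableSet_le measurable_const measurable_norm
  have h1 (x : ℝ) : (∫⁻ t in {t : ℝ | |t| ≤ |x|}, φ t) ^ 2 ≤
      4 * ENNReal.ofReal (|x| ^ (1 / 2 : ℝ)) *
        ∫⁻ t in {t : ℝ | |t| ≤ |x|}, ENNReal.ofReal (|t| ^ (1 / 2 : ℝ)) * φ t ^ 2 := by
    rw [← lintegral_abs_rpow_neg_half]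
    refine sq_lintegral_le_mul (by fun_prop) (by fun_prop) (ae_restrict_of_ae ?_)
    -- At `t = 0` the real power `0 ^ (-1/2)` is `0`, so the two weights do not cancel there; the
    -- point is null.
    filter_upwards [Measure.ae_ne volume (0 : ℝ)] with t ht
    have ht0 : 0 < |t| := abs_pos.2 ht
    rw [← mul_assoc, ← ENNReal.ofReal_mul (by positivity), ← Real.rpow_add ht0]
    norm_num
  have hmp : MeasurableSet {q : ℝ × ℝ | |q.2| ≤ |q.1|} :=
    measurableSet_le measurable_snd.norm measurable_fst.norm
  calc _ ≤ ∫⁻ x, 4 * ENNReal.ofReal (|x| ^ (1 / 2 : ℝ)) *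
        (∫⁻ t in {t : ℝ | |t| ≤ |x|}, ENNReal.ofReal (|t| ^ (1 / 2 : ℝ)) * φ t ^ 2) ∂ν :=
        lintegral_mono h1
    _ = ∫⁻ x, (∫⁻ t, {q : ℝ × ℝ | |q.2| ≤ |q.1|}.indicator (fun q =>
          4 * ENNReal.ofReal (|q.1| ^ (1 / 2 : ℝ)) *
          (ENNReal.ofReal (|q.2| ^ (1 / 2 : ℝ)) * φ q.2 ^ 2)) (x, t)) ∂ν := by
        refine lintegral_congr fun x => ?_
        rw [← lintegral_const_mul _ (by fun_prop), ← lintegral_indicator (hmeas x)]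
        rfl
    _ = ∫⁻ t, ∫⁻ x, {q : ℝ × ℝ | |q.2| ≤ |q.1|}.indicator (fun q =>
          4 * ENNReal.ofReal (|q.1| ^ (1 / 2 : ℝ)) *
          (ENNReal.ofReal (|q.2| ^ (1 / 2 : ℝ)) * φ q.2 ^ 2)) (x, t) ∂ν := by
        refine lintegral_lintegral_swap (Measurable.aemeasurable ?_)
        exact Measurable.indicator (by fun_prop) hmp
    _ = ∫⁻ t, 4 * (ENNReal.ofReal (|t| ^ (1 / 2 : ℝ)) *
          ∫⁻ x in {x : ℝ | |t| ≤ |x|}, ENNReal.ofReal (|x| ^ (1 / 2 : ℝ)) ∂ν) * φ t ^ 2 := by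
        refine lintegral_congr fun t => ?_
        rw [← lintegral_const_mul _ (by fun_prop), ← lintegral_const_mul _ (by fun_prop),
          ← lintegral_mul_const _ (by fun_prop), ← lintegral_indicator (hmeas' t)]
        refine lintegral_congr fun x => ?_
        simp only [Set.indicator, Set.mem_ofPred_eq]
        split_ifs
        · ring
        · rfl
    _ ≤ ∫⁻ t, 8 * B * φ t ^ 2 := by
        refine lintegral_mono_ae ?_
        filter_upwards [Measure.ae_ne volume (0 : ℝ)] with t ht
        calc _ ≤ 4 * (2 * B) * φ t ^ 2 := 
              mul_le_mul' (mul_le_mul' le_rfl (lintegral_tail_sqrt_le hB ht)) le_rfl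
          _ = _ := by ring
    _ = _ := lintegral_const_mul _ (by fun_prop)

/-! ### The measure `μ`, its tails and `Φ` -/

lemma measurable_ofReal_inv {a : ℝ → ℝ} (ha : Measurable a) :
    Measurable fun x => ENNReal.ofReal (a x)⁻¹ := ha.inv.ennreal_ofReal

lemma mu_apply (a : ℝ → ℝ) {S : Set ℝ} (hS : MeasurableSet S) :
    mu a S = ∫⁻ s in S, ENNReal.ofReal (a s)⁻¹ := withDensity_apply _ hS

lemma isProbabilityMeasure_mu {a : ℝ → ℝ} (h : ∫⁻ x, ENNReal.ofReal (a x)⁻¹ = 1) :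
    IsProbabilityMeasure (mu a) := ⟨by rw [mu_apply a MeasurableSet.univ]; simpa using h⟩

lemma mu_absolutelyContinuous (a : ℝ → ℝ) : mu a ≪ volume := withDensity_absolutelyContinuous _ _

lemma measurableSet_le_abs (x : ℝ) : MeasurableSet {s : ℝ | x ≤ |s|} :=
  measurableSet_le measurable_const measurable_norm

lemma measurableSet_abs_le (x : ℝ) : MeasurableSet {s : ℝ | |s| ≤ x} :=
  measurableSet_le measurable_norm measurable_const

lemma tailLimsup_eq (a : ℝ → ℝ) :
    tailLimsup a = limsup (fun x : ℝ => ‖x‖ₑ * mu a {s : ℝ | |x| ≤ |s|}) (cocompact ℝ) := by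
  simp_rw [mu_apply a (measurableSet_le_abs _)]; rfl

lemma eventually_cocompact_real {p : ℝ → Prop} :
    (∀ᶠ x in cocompact ℝ, p x) ↔ ∃ R : ℝ, 0 < R ∧ ∀ x, R ≤ |x| → p x := by
  rw [← Metric.cobounded_eq_cocompact,
    (Metric.hasBasis_cobounded_compl_closedBall (0 : ℝ)).eventually_iff]
  constructor
  · rintro ⟨R, -, h⟩
    refine ⟨|R| + 1, by positivity, fun x hx => h ?_⟩
    simp only [Set.mem_compl_iff, Metric.mem_closedBall, dist_zero_right, Real.norm_eq_abs, not_le]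
    exact (le_abs_self R).trans_lt ((lt_add_one _).trans_le hx)
  · rintro ⟨R, -, h⟩
    refine ⟨R, trivial, fun x hx => h x ?_⟩
    simp only [Set.mem_compl_iff, Metric.mem_closedBall, dist_zero_right, Real.norm_eq_abs,
      not_le] at hx
    exact hx.le

/-- The limsup only controls large `|x|`; on `|x| ≤ R` the total mass 1 gives the bound `R`. -/
lemma exists_tail_bound {a : ℝ → ℝ} [IsProbabilityMeasure (mu a)] (h : tailLimsup a < ∞) :
    ∃ B : ℝ, 0 < B ∧ ∀ x : ℝ, ‖x‖ₑ * mu a {s : ℝ | |x| ≤ |s|} ≤ ENNReal.ofReal B := by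
  obtain ⟨c, hc, hc'⟩ := exists_between h
  rw [tailLimsup_eq] at hc
  obtain ⟨R, hR, hR'⟩ := eventually_cocompact_real.1 (eventually_lt_of_limsup_lt hc)
  refine ⟨max R c.toReal, lt_max_of_lt_left hR, fun x => ?_⟩
  rcases le_total R |x| with hx | hx
  · exact (hR' x hx).le.trans (ENNReal.le_ofReal_iff_toReal_le hc'.ne (by positivity) |>.2
      (le_max_right _ _))
  · calc _ ≤ ‖x‖ₑ * 1 := by gcongr; exact prob_le_one
      _ ≤ _ := by
        rw [mul_one, Real.enorm_eq_ofReal_abs]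
        exact ENNReal.ofReal_le_ofReal (hx.trans (le_max_left _ _))

/-- Tails of `μ` restricted to a set on which its density is at most `c (1 + |x|)⁻²`. -/
lemma restrict_tail_le {a : ℝ → ℝ} {S : Set ℝ} (hS : MeasurableSet S) {c : ℝ≥0∞}
    (h : ∀ x ∈ S, ENNReal.ofReal (a x)⁻¹ ≤ c * ENNReal.ofReal (((1 + |x|) ^ 2)⁻¹)) (x : ℝ) :
    (mu a).restrict S {s : ℝ | |x| ≤ |s|} ≤ 2 * c * ENNReal.ofReal ((1 + |x|)⁻¹) := by
  have hT := measurableSet_le_abs |x|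
  rw [Measure.restrict_apply hT, mu_apply a (hT.inter hS)]
  calc _ ≤ ∫⁻ s in {s : ℝ | |x| ≤ |s|} ∩ S, c * ENNReal.ofReal (((1 + |s|) ^ 2)⁻¹) :=
        setLIntegral_mono' (hT.inter hS) fun s hs => h s hs.2
    _ ≤ ∫⁻ s in {s : ℝ | |x| ≤ |s|}, c * ENNReal.ofReal (((1 + |s|) ^ 2)⁻¹) :=
        lintegral_mono_set Set.inter_subset_left
    _ = _ := by
        rw [lintegral_const_mul _ (by fun_prop), lintegral_tail_inv_sq]; ring

lemma restrict_univ_le {a : ℝ → ℝ} {S : Set ℝ} (hS : MeasurableSet S) {c : ℝ≥0∞}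
    (h : ∀ x ∈ S, ENNReal.ofReal (a x)⁻¹ ≤ c * ENNReal.ofReal (((1 + |x|) ^ 2)⁻¹)) :
    mu a S ≤ 2 * c := by
  simpa using restrict_tail_le hS h 0

/-- The density `c (1+|s|)⁻²` has tails `2c / (1+|x|)`. This turns lower bounds on `a(x) / (1+|x|)²`
over `S` into the hypothesis of `hardy`; `S` is an outer region for `Φ` and a ball for `Φ₀`. -/
lemma enorm_mul_restrict_tail_le {a : ℝ → ℝ} {S : Set ℝ} (hS : MeasurableSet S) {c : ℝ≥0∞}
    (h : ∀ x ∈ S, ENNReal.ofReal (a x)⁻¹ ≤ c * ENNReal.ofReal (((1 + |x|) ^ 2)⁻¹)) (x : ℝ) :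
    ‖x‖ₑ * (mu a).restrict S {s : ℝ | |x| ≤ |s|} ≤ 2 * c := by
  calc _ ≤ ‖x‖ₑ * (2 * c * ENNReal.ofReal ((1 + |x|)⁻¹)) := by
        gcongr; exact restrict_tail_le hS h x
    _ = 2 * c * ENNReal.ofReal (|x| * (1 + |x|)⁻¹) := by
        rw [ENNReal.ofReal_mul (abs_nonneg x), Real.enorm_eq_ofReal_abs]; ring
    _ ≤ 2 * c * 1 := by
        gcongr
        rw [ENNReal.ofReal_le_one, ← div_eq_mul_inv, div_le_one (by positivity)]
        linarith
    _ = _ := mul_one _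

lemma ofReal_inv_le_of_le {y x : ℝ} (hy : 0 < y) {t : ℝ≥0∞}
    (ht : t ≤ ENNReal.ofReal (y / (1 + |x|) ^ 2)) :
    ENNReal.ofReal y⁻¹ ≤ t⁻¹ * ENNReal.ofReal (((1 + |x|) ^ 2)⁻¹) := by
  calc _ = (ENNReal.ofReal (y / (1 + |x|) ^ 2))⁻¹ * ENNReal.ofReal (((1 + |x|) ^ 2)⁻¹) := by
        rw [← ENNReal.ofReal_inv_of_pos (by positivity), ← ENNReal.ofReal_mul (by positivity)]
        congr 1
        field_simp
    _ ≤ _ := by gcongr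

/-- If `Φ` exceeds `t` at some finite radius, the tail quantity is at most `2 / t`. -/
lemma tailLimsup_le_of_le_Phi {a : ℝ → ℝ} (ha_pos : ∀ x, 0 < a x) {t : ℝ≥0∞} {r : ℝ≥0}
    (h : t ≤ Phi a r) : tailLimsup a ≤ 2 * t⁻¹ := by
  rw [tailLimsup_eq]
  refine limsup_le_of_le (by isBoundedDefault) (eventually_cocompact_real.2 ⟨r + 1, by positivity, fun x hx => ?_⟩)
  have hr : ∀ y ∈ {s : ℝ | (r : ℝ) ≤ |s|},
      ENNReal.ofReal (a y)⁻¹ ≤ t⁻¹ * ENNReal.ofReal (((1 + |y|) ^ 2)⁻¹) := by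
    intro y hy
    refine ofReal_inv_le_of_le (ha_pos y) (h.trans (iInf₂_le y ?_))
    rw [Real.enorm_eq_ofReal_abs, ← ENNReal.ofReal_coe_nnreal]
    exact ENNReal.ofReal_le_ofReal hy
  convert! enorm_mul_restrict_tail_le (measurableSet_le_abs _) hr x using 2
  rw [Measure.restrict_apply (measurableSet_le_abs _), Set.inter_eq_left.2]
  intro s hs
  have : |x| ≤ |s| := hs
  show (r : ℝ) ≤ |s|
  linarith

/-! ### Pointwise bounds by window averages -/

/-- Average `|g y| ≤ |g t| + ∫ |g'|` over `t` in the window. The window is cut to `[-R, R]`, where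
density bounds are available; since `ℓ ≤ R`, one of `[y - ℓ, y]`, `[y, y + ℓ]` survives the cut, so
its length is still at least `ℓ`. -/
lemma LocallyAC.enorm_le {g : ℝ → ℝ} (hg : LocallyAC g) {R ℓ y : ℝ} (hℓ : 0 < ℓ) (hℓR : ℓ ≤ R)
    (hy : |y| ≤ R) : ‖g y‖ₑ ≤
      ENNReal.ofReal ℓ⁻¹ * (∫⁻ t in {t : ℝ | |t - y| ≤ ℓ ∧ |t| ≤ R}, ‖g t‖ₑ) +
        ∫⁻ t in {t : ℝ | |t - y| ≤ ℓ ∧ |t| ≤ R}, ‖deriv g t‖ₑ := by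
  set J := {t : ℝ | |t - y| ≤ ℓ ∧ |t| ≤ R} with hJ
  have hJ' : J = Set.Icc (max (y - ℓ) (-R)) (min (y + ℓ) R) := by
    ext t
    simp only [hJ, Set.mem_ofPred_eq, abs_le, Set.mem_Icc, max_le_iff, le_min_iff]
    constructor
    · rintro ⟨⟨h1, h2⟩, h3, h4⟩; exact ⟨⟨by linarith, h3⟩, by linarith, h4⟩
    · rintro ⟨⟨h1, h2⟩, h3, h4⟩; exact ⟨⟨by linarith, by linarith⟩, h2, h4⟩
  have hyJ : y ∈ J := ⟨by simpa using hℓ.le, hy⟩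
  have hmJ : MeasurableSet J := hJ' ▸ measurableSet_Icc
  have hV : ENNReal.ofReal ℓ ≤ volume J := by
    rw [hJ', Real.volume_Icc]
    refine ENNReal.ofReal_le_ofReal ?_
    rw [abs_le] at hy
    rcases max_cases (y - ℓ) (-R) with h | h <;> rcases min_cases (y + ℓ) R with h' | h' <;>
      linarith
  have hV' : volume J ≠ ∞ := by rw [hJ', Real.volume_Icc]; exact ENNReal.ofReal_ne_top
  have hV0 : volume J ≠ 0 := (lt_of_lt_of_le (ENNReal.ofReal_pos.2 hℓ) hV).ne'
  have h1 (t : ℝ) (ht : t ∈ J) : ‖g y‖ₑ ≤ ‖g t‖ₑ + ∫⁻ t in J, ‖deriv g t‖ₑ := by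
    have h2 : Set.uIcc y t ⊆ J := by
      rw [hJ'] at ht hyJ ⊢
      exact Set.ordConnected_Icc.uIcc_subset hyJ ht
    calc ‖g y‖ₑ = ‖g t + (g y - g t)‖ₑ := by congr 1; ring
      _ ≤ _ := (enorm_add_le _ _).trans (by gcongr; exact hg.enorm_sub_le h2)
  have h3 : ‖g y‖ₑ * volume J ≤ (∫⁻ t in J, ‖g t‖ₑ) + (∫⁻ t in J, ‖deriv g t‖ₑ) * volume J := by
    calc _ = ∫⁻ t in J, ‖g y‖ₑ := (setLIntegral_const _ _).symm
      _ ≤ ∫⁻ t in J, (‖g t‖ₑ + ∫⁻ t in J, ‖deriv g t‖ₑ) := setLIntegral_mono' hmJ h1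
      _ = _ := by rw [lintegral_add_right _ measurable_const, setLIntegral_const]
  calc ‖g y‖ₑ = ‖g y‖ₑ * volume J * (volume J)⁻¹ := by
        rw [mul_assoc, ENNReal.mul_inv_cancel hV0 hV', mul_one]
    _ ≤ ((∫⁻ t in J, ‖g t‖ₑ) + (∫⁻ t in J, ‖deriv g t‖ₑ) * volume J) * (volume J)⁻¹ := by gcongr
    _ = (volume J)⁻¹ * (∫⁻ t in J, ‖g t‖ₑ) + ∫⁻ t in J, ‖deriv g t‖ₑ := by
        rw [add_mul, mul_assoc, ENNReal.mul_inv_cancel hV0 hV', mul_one, mul_comm]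
    _ ≤ _ := by
        rw [ENNReal.ofReal_inv_of_pos hℓ]
        gcongr

lemma volume_window_le (R ℓ y : ℝ) :
    volume {t : ℝ | |t - y| ≤ ℓ ∧ |t| ≤ R} ≤ 2 * ENNReal.ofReal ℓ := by
  calc _ ≤ volume (Metric.closedBall y ℓ) := measure_mono fun t ht => by
        simpa [Real.dist_eq] using ht.1
    _ = _ := by rw [Real.volume_closedBall, ENNReal.ofReal_mul (by norm_num)]; simp

lemma measurableSet_window (R ℓ y : ℝ) : MeasurableSet {t : ℝ | |t - y| ≤ ℓ ∧ |t| ≤ R} :=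
  (measurableSet_le (f := fun t : ℝ => |t - y|) (by fun_prop) measurable_const).inter
    (measurableSet_abs_le R)

lemma LocallyAC.enorm_sq_le {g : ℝ → ℝ} (hg : LocallyAC g) {R ℓ y : ℝ} (hℓ : 0 < ℓ) (hℓR : ℓ ≤ R)
    (hy : |y| ≤ R) : ‖g y‖ₑ ^ 2 ≤
      2 * ENNReal.ofReal ℓ⁻¹ ^ 2 * (∫⁻ t in {t : ℝ | |t - y| ≤ ℓ ∧ |t| ≤ R}, ‖g t‖ₑ) ^ 2 +
        4 * ENNReal.ofReal ℓ * ∫⁻ t in {t : ℝ | |t - y| ≤ ℓ ∧ |t| ≤ R}, ‖deriv g t‖ₑ ^ 2 := by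
  set J := {t : ℝ | |t - y| ≤ ℓ ∧ |t| ≤ R} with hJ
  have hcs : (∫⁻ t in J, ‖deriv g t‖ₑ) ^ 2 ≤
      2 * ENNReal.ofReal ℓ * ∫⁻ t in J, ‖deriv g t‖ₑ ^ 2 := by
    refine (sq_lintegral_le_mul (u := fun _ => 1) (p := fun t => ‖deriv g t‖ₑ ^ 2) (by fun_prop)
      ((measurable_enorm_deriv g).pow_const 2).aemeasurable (by simp)).trans ?_
    gcongr
    simpa using volume_window_le R ℓ y
  calc _ ≤ (ENNReal.ofReal ℓ⁻¹ * (∫⁻ t in J, ‖g t‖ₑ) + ∫⁻ t in J, ‖deriv g t‖ₑ) ^ 2 := by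
        gcongr; exact hg.enorm_le hℓ hℓR hy
    _ ≤ _ := ennreal_add_sq_le _ _
    _ ≤ 2 * (ENNReal.ofReal ℓ⁻¹ * ∫⁻ t in J, ‖g t‖ₑ) ^ 2 +
        2 * (2 * ENNReal.ofReal ℓ * ∫⁻ t in J, ‖deriv g t‖ₑ ^ 2) := by gcongr
    _ = _ := by ring

lemma InDomain.exists_locallyAC {a f : ℝ → ℝ} (hf : InDomain a f) :
    ∃ g : ℝ → ℝ, LocallyAC g ∧ f =ᵐ[mu a] g ∧ ∫⁻ x, ‖deriv g x‖ₑ ^ 2 = 2 * energy f := by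
  obtain ⟨g, hg⟩ := iInf_lt_iff.1 hf.2
  obtain ⟨⟨hg, hfg⟩, -⟩ := iInf_lt_iff.1 hg
  refine ⟨g, hg, (mu_absolutelyContinuous a).ae_eq hfg, ?_⟩
  rw [energy_eq hg hfg, ← mul_assoc, ENNReal.mul_inv_cancel (by norm_num) (by norm_num), one_mul]

lemma LocallyAC.enorm_sub_zero_le {g : ℝ → ℝ} (hg : LocallyAC g) (x : ℝ) :
    ‖g x - g 0‖ₑ ≤ ∫⁻ t in {t : ℝ | |t| ≤ |x|}, ‖deriv g t‖ₑ := by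
  refine hg.enorm_sub_le ?_
  have : {t : ℝ | |t| ≤ |x|} = Set.Icc (-|x|) |x| := by ext t; simp [abs_le]
  rw [this]
  exact Set.ordConnected_Icc.uIcc_subset ⟨neg_abs_le x, le_abs_self x⟩ (by simp)

/-! ### Variance and the Poincaré inequality -/

lemma lintegral_enorm_sq {α : Type*} [MeasurableSpace α] {ν : Measure α} {f : α → ℝ}
    (hf : MemLp f 2 ν) : ∫⁻ x, ‖f x‖ₑ ^ 2 ∂ν = ENNReal.ofReal (∫ x, f x ^ 2 ∂ν) := by
  rw [ofReal_integral_eq_lintegral_ofReal hf.integrable_sq (ae_of_all _ fun x => sq_nonneg _)]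
  refine lintegral_congr fun x => ?_
  rw [Real.enorm_eq_ofReal_abs, ← ENNReal.ofReal_pow (abs_nonneg _), sq_abs]

lemma integral_sub_const_sq {α : Type*} [MeasurableSpace α] {ν : Measure α} [IsFiniteMeasure ν]
    {f : α → ℝ} (hf : MemLp f 2 ν) (c : ℝ) :
    ∫ x, (f x - c) ^ 2 ∂ν = ∫ x, f x ^ 2 ∂ν - 2 * c * ∫ x, f x ∂ν + c ^ 2 * ν.real Set.univ := by
  have h1 := hf.integrable_sq
  have h2 : Integrable (fun x => 2 * c * f x) ν := (hf.integrable (by norm_num)).const_mul _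
  have h3 : Integrable (fun x => f x ^ 2 - 2 * c * f x) ν := h1.sub h2
  calc _ = ∫ x, (f x ^ 2 - 2 * c * f x + c ^ 2) ∂ν := by congr 1; ext x; ring
    _ = _ := by
      rw [integral_add h3 (integrable_const _), integral_sub h1 h2, integral_const_mul,
        integral_const, smul_eq_mul, mul_comm (c ^ 2)]

lemma lintegral_sub_const_sq {α : Type*} [MeasurableSpace α] {ν : Measure α} [IsFiniteMeasure ν]
    {f : α → ℝ} (hf : MemLp f 2 ν) (c : ℝ) :
    ∫⁻ x, ‖f x - c‖ₑ ^ 2 ∂ν =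
      ENNReal.ofReal (∫ x, f x ^ 2 ∂ν - 2 * c * ∫ x, f x ∂ν + c ^ 2 * ν.real Set.univ) := by
  have h : MemLp (fun x => f x - c) 2 ν := hf.sub (memLp_const c)
  rw [lintegral_enorm_sq h, integral_sub_const_sq hf]

/-- Among constants, the mean minimizes the mean square distance. -/
lemma lintegral_sub_mean_sq_le {α : Type*} [MeasurableSpace α] {ν : Measure α}
    [IsProbabilityMeasure ν] {f : α → ℝ} (hf : MemLp f 2 ν) (c : ℝ) :
    ∫⁻ x, ‖f x - ∫ y, f y ∂ν‖ₑ ^ 2 ∂ν ≤ ∫⁻ x, ‖f x - c‖ₑ ^ 2 ∂ν := by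
  rw [lintegral_sub_const_sq hf, lintegral_sub_const_sq hf, probReal_univ]
  refine ENNReal.ofReal_le_ofReal ?_
  nlinarith [sq_nonneg (c - ∫ x, f x ∂ν)]

/-- The second moment is the variance plus the squared mean, and the mean is at most the `L¹` norm.
-/
lemma lintegral_sq_le_variance_add {α : Type*} [MeasurableSpace α] {ν : Measure α}
    [IsProbabilityMeasure ν] {f : α → ℝ} (hf : MemLp f 2 ν) :
    ∫⁻ x, ‖f x‖ₑ ^ 2 ∂ν ≤ ∫⁻ x, ‖f x - ∫ y, f y ∂ν‖ₑ ^ 2 ∂ν + (∫⁻ x, ‖f x‖ₑ ∂ν) ^ 2 := by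
  have h1 : ENNReal.ofReal ((∫ y, f y ∂ν) ^ 2) ≤ (∫⁻ x, ‖f x‖ₑ ∂ν) ^ 2 := by
    rw [← sq_abs, ENNReal.ofReal_pow (abs_nonneg _), ← Real.enorm_eq_ofReal_abs]
    gcongr
    exact enorm_integral_le_lintegral_enorm _
  refine le_trans ?_ (add_le_add_right h1 _)
  rw [lintegral_enorm_sq hf, lintegral_sub_const_sq hf, probReal_univ]
  refine le_trans (ENNReal.ofReal_le_ofReal ?_) ENNReal.ofReal_add_le
  exact le_of_eq (by ring)

lemma Poincare.lintegral_sq_le {a : ℝ → ℝ} [IsProbabilityMeasure (mu a)] {C : ℝ}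
    (h : Poincare a C) {f : ℝ → ℝ} (hf : InDomain a f) :
    ∫⁻ x, ‖f x‖ₑ ^ 2 ∂(mu a) ≤ ENNReal.ofReal C * energy f + (∫⁻ x, ‖f x‖ₑ ∂(mu a)) ^ 2 :=
  (lintegral_sq_le_variance_add hf.1).trans (add_le_add_left (h f hf) _)

/-- Tail bounds imply the Poincaré inequality. -/
lemma poincare_of_tail_bound {a : ℝ → ℝ} [IsProbabilityMeasure (mu a)] {B : ℝ}
    (hB : ∀ x : ℝ, ‖x‖ₑ * mu a {s : ℝ | |x| ≤ |s|} ≤ ENNReal.ofReal B) : Poincare a (16 * B) := by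
  intro f hf
  obtain ⟨g, hg, hfg, hD⟩ := hf.exists_locallyAC
  calc _ ≤ ∫⁻ x, ‖f x - g 0‖ₑ ^ 2 ∂(mu a) := lintegral_sub_mean_sq_le hf.1 _
    _ = ∫⁻ x, ‖g x - g 0‖ₑ ^ 2 ∂(mu a) :=
        lintegral_congr_ae (hfg.mono fun x hx => by simp only [hx])
    _ ≤ ∫⁻ x, (∫⁻ t in {t : ℝ | |t| ≤ |x|}, ‖deriv g t‖ₑ) ^ 2 ∂(mu a) := by
        gcongr with x
        exact hg.enorm_sub_zero_le x
    _ ≤ _ := hardy hB (measurable_enorm_deriv g)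
    _ = _ := by
        rw [hD, ENNReal.ofReal_mul (by norm_num), ENNReal.ofReal_ofNat]
        ring

/-! ### Necessity of the tail conditions -/

/-- The truncated distance to `(-x/2, x/2)`, used as a test function. -/
noncomputable def ramp (x t : ℝ) : ℝ := min (max (|t| - x / 2) 0) (x / 2)

lemma ramp_nonneg {x : ℝ} (hx : 0 < x) (t : ℝ) : 0 ≤ ramp x t :=
  le_min (le_max_right _ _) (by positivity)

lemma ramp_le (x t : ℝ) : ramp x t ≤ x / 2 := min_le_right _ _

lemma ramp_of_le {x t : ℝ} (hx : 0 < x) (ht : |t| ≤ x / 2) : ramp x t = 0 := by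
  rw [ramp, max_eq_right (by linarith), min_eq_left (by positivity)]

lemma ramp_of_ge {x t : ℝ} (ht : x ≤ |t|) : ramp x t = x / 2 :=
  min_eq_right (le_max_of_le_left (by linarith))

lemma lipschitzWith_ramp (x : ℝ) : LipschitzWith 1 (ramp x) := by
  have h1 : LipschitzWith 1 fun t : ℝ => |t| - x / 2 := by
    refine LipschitzWith.of_dist_le_mul fun s t => ?_
    simp only [Real.dist_eq, sub_sub_sub_cancel_right, NNReal.coe_one, one_mul]
    exact abs_abs_sub_abs_le s t
  exact (h1.max_const 0).min_const (x / 2)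

lemma deriv_ramp_eq_zero {x t : ℝ} (hx : 0 < x) (ht : |t| < x / 2 ∨ x < |t|) :
    deriv (ramp x) t = 0 := by
  rcases ht with ht | ht
  · have : ramp x =ᶠ[𝓝 t] fun _ => 0 :=
      (continuous_abs.continuousAt.eventually_lt continuousAt_const ht).mono fun s hs =>
        ramp_of_le hx (le_of_lt hs)
    simp [this.deriv_eq]
  · have : ramp x =ᶠ[𝓝 t] fun _ => x / 2 :=
      (continuousAt_const.eventually_lt continuous_abs.continuousAt ht).mono fun s hs =>
        ramp_of_ge (le_of_lt hs)
    simp [this.deriv_eq]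

/-- The slope is at most 1 in absolute value and vanishes off two intervals of length `x/2`; the
factor `1/2` in the energy halves their total length `x`. -/
lemma energy_ramp_le {x : ℝ} (hx : 0 < x) : energy (ramp x) ≤ ENNReal.ofReal (x / 2) := by
  have hAC : LocallyAC (ramp x) := fun b c =>
    ((lipschitzWith_ramp x).lipschitzOnWith).absolutelyContinuousOnInterval
  set S := Set.Icc (x / 2) x ∪ Set.Icc (-x) (-(x / 2)) with hS
  have hmS : MeasurableSet S := measurableSet_Icc.union measurableSet_Icc
  rw [energy_eq hAC EventuallyEq.rfl]
  calc _ ≤ 2⁻¹ * ∫⁻ t, S.indicator 1 t := by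
        gcongr with t
        by_cases ht : t ∈ S
        · rw [Set.indicator_of_mem ht]
          refine pow_le_one₀ zero_le ?_
          rw [Real.enorm_eq_ofReal_abs, ENNReal.ofReal_le_one]
          simpa using norm_deriv_le_of_lipschitz (lipschitzWith_ramp x) (x₀ := t)
        · rw [deriv_ramp_eq_zero hx]
          · simp
          · by_contra! h
            refine ht ?_
            rcases abs_cases t with h' | h'
            · exact Or.inl ⟨by linarith, by linarith⟩
            · exact Or.inr ⟨by linarith, by linarith⟩
    _ = 2⁻¹ * volume S := by rw [lintegral_indicator_one hmS]
    _ ≤ 2⁻¹ * (ENNReal.ofReal (x / 2) + ENNReal.ofReal (x / 2)) := by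
        gcongr
        refine (measure_union_le _ _).trans (le_of_eq ?_)
        rw [Real.volume_Icc, Real.volume_Icc]
        ring_nf
    _ = _ := by
        rw [← two_mul, ← mul_assoc, ENNReal.inv_mul_cancel (by norm_num) (by norm_num), one_mul]

lemma inDomain_ramp (a : ℝ → ℝ) [IsProbabilityMeasure (mu a)] {x : ℝ} (hx : 0 < x) :
    InDomain a (ramp x) := by
  refine ⟨?_, (energy_ramp_le hx).trans_lt ENNReal.ofReal_lt_top⟩
  refine MemLp.of_bound (lipschitzWith_ramp x).continuous.aestronglyMeasurable (x / 2)
    (ae_of_all _ fun t => ?_)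
  rw [Real.norm_of_nonneg (ramp_nonneg hx t)]
  exact ramp_le x t

lemma exists_tail_measure_le {ν : Measure ℝ} [IsFiniteMeasure ν] {ε : ℝ≥0∞} (hε : 0 < ε) :
    ∃ R : ℝ, 0 < R ∧ ν {s : ℝ | R ≤ |s|} ≤ ε := by
  have h : Tendsto (fun n : ℕ => ν {s : ℝ | (n : ℝ) ≤ |s|}) atTop
      (𝓝 (ν (⋂ n : ℕ, {s : ℝ | (n : ℝ) ≤ |s|}))) := by
    refine tendsto_measure_iInter_atTop (fun n => (measurableSet_le_abs _).nullMeasurableSet) ?_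
      ⟨0, measure_ne_top _ _⟩
    intro m n hmn s hs
    exact le_trans (Nat.cast_le.2 hmn) (show (n : ℝ) ≤ |s| from hs)
  have h0 : (⋂ n : ℕ, {s : ℝ | (n : ℝ) ≤ |s|}) = ∅ := by
    refine Set.eq_empty_of_forall_notMem fun s hs => ?_
    obtain ⟨n, hn⟩ := exists_nat_gt |s|
    exact absurd (Set.mem_iInter.1 hs n) (not_le.2 hn)
  rw [h0, measure_empty] at h
  obtain ⟨n, hn, hn0⟩ := ((h.eventually_lt_const hε).and (eventually_gt_atTop 0)).exists
  exact ⟨n, by exact_mod_cast hn0, hn.le⟩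

/-- A defective Poincaré inequality controls the tail of `μ`. -/
lemma tailLimsup_le_of_defective_poincare {a : ℝ → ℝ} [IsProbabilityMeasure (mu a)] {r b : ℝ≥0∞}
    (hb : b ≠ ∞) (h : ∀ f : ℝ → ℝ, InDomain a f → ∫⁻ x, ‖f x‖ₑ ^ 2 ∂(mu a) ≤
      r * energy f + b * (∫⁻ x, ‖f x‖ₑ ∂(mu a)) ^ 2) : tailLimsup a ≤ 4 * r := by
  -- For `x ≥ 2R` the ramp is supported in `|t| ≥ R`, so with this mass the `L¹` term is at most
  -- half of the `L²` term.
  obtain ⟨R, hR, hRb⟩ := exists_tail_measure_le (ν := mu a) (ε := (2 * b)⁻¹)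
    (ENNReal.inv_pos.2 (ENNReal.mul_ne_top (by norm_num) hb))
  rw [tailLimsup_eq]
  refine limsup_le_of_le (by isBoundedDefault)
    (eventually_cocompact_real.2 ⟨2 * R, by positivity, fun y hy => ?_⟩)
  rw [Real.enorm_eq_ofReal_abs]
  set x := |y| with hxy
  have hx : 0 < x := by linarith
  set M := ∫⁻ t, ‖ramp x t‖ₑ ^ 2 ∂(mu a) with hM
  have henorm (t : ℝ) : ‖ramp x t‖ₑ = ENNReal.ofReal (ramp x t) := by
    rw [Real.enorm_eq_ofReal_abs, abs_of_nonneg (ramp_nonneg hx t)]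
  have hmeas : Measurable fun t => ‖ramp x t‖ₑ ^ 2 :=
    ((lipschitzWith_ramp x).continuous.measurable.enorm).pow_const 2
  -- Finiteness is what allows `2⁻¹ * M` to be cancelled from both sides.
  have hM_top : M ≠ ∞ := by
    rw [hM, lintegral_enorm_sq (inDomain_ramp a hx).1]; exact ENNReal.ofReal_ne_top
  have hM_ge : ENNReal.ofReal (x / 2) ^ 2 * mu a {s : ℝ | x ≤ |s|} ≤ M := by
    rw [← setLIntegral_const]
    refine (setLIntegral_mono' (measurableSet_le_abs x) fun t ht => ?_).trans
      (setLIntegral_le_lintegral _ _)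
    rw [henorm, ramp_of_ge ht]
  have hL1 : (∫⁻ t, ‖ramp x t‖ₑ ∂(mu a)) ^ 2 ≤ mu a {s : ℝ | R ≤ |s|} * M := by
    rw [← lintegral_indicator_one (measurableSet_le_abs R)]
    refine sq_lintegral_le_mul
      (measurable_one.indicator (measurableSet_le_abs R)).aemeasurable hmeas.aemeasurable
      (ae_of_all _ fun t => ?_)
    by_cases ht : R ≤ |t|
    · rw [Set.indicator_of_mem (show t ∈ {s : ℝ | R ≤ |s|} from ht)]; simp
    · rw [ramp_of_le hx (by linarith [not_le.1 ht])]; simp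
  have hbb : b * (∫⁻ t, ‖ramp x t‖ₑ ∂(mu a)) ^ 2 ≤ 2⁻¹ * M := by
    calc _ ≤ b * ((2 * b)⁻¹ * M) := by gcongr; exact hL1.trans (by gcongr)
      _ = b * b⁻¹ * (2⁻¹ * M) := by
        rw [ENNReal.mul_inv (by simp) (by simp)]; ring
      _ ≤ 1 * (2⁻¹ * M) := by gcongr; exact ENNReal.mul_inv_le_one b
      _ = _ := one_mul _
  have hle : M ≤ r * ENNReal.ofReal (x / 2) + 2⁻¹ * M :=
    (h _ (inDomain_ramp a hx)).trans (by gcongr; exact energy_ramp_le hx)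
  have hM2 : M = 2⁻¹ * M + 2⁻¹ * M := by rw [← add_mul, ENNReal.inv_two_add_inv_two, one_mul]
  have hle2 : 2⁻¹ * M ≤ r * ENNReal.ofReal (x / 2) := by
    have hfin : 2⁻¹ * M ≠ ∞ := ENNReal.mul_ne_top (by norm_num) hM_top
    rw [← ENNReal.add_le_add_iff_right hfin, ← hM2]
    exact hle
  have hx2 : ENNReal.ofReal x = ENNReal.ofReal (4 / x) * ENNReal.ofReal (x / 2) ^ 2 := by
    rw [← ENNReal.ofReal_pow (by positivity), ← ENNReal.ofReal_mul (by positivity)]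
    congr 1; field_simp; norm_num
  calc _ = ENNReal.ofReal (4 / x) * (ENNReal.ofReal (x / 2) ^ 2 * mu a {s : ℝ | x ≤ |s|}) := by
        rw [hx2, mul_assoc]
    _ ≤ ENNReal.ofReal (4 / x) * M := by gcongr
    _ = ENNReal.ofReal (4 / x) * (2⁻¹ * M + 2⁻¹ * M) := by rw [← hM2]
    _ ≤ ENNReal.ofReal (4 / x) * (r * ENNReal.ofReal (x / 2) + r * ENNReal.ofReal (x / 2)) := by
        gcongr
    _ = (ENNReal.ofReal (4 / x) * ENNReal.ofReal (x / 2)) * 2 * r := by ring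
    _ = 4 * r := by
        rw [← ENNReal.ofReal_mul (by positivity), ← ENNReal.ofReal_ofNat 2,
          ← ENNReal.ofReal_mul (by positivity), ← ENNReal.ofReal_ofNat 4]
        congr 2; field_simp

/-! ### Super Poincaré with some finite rate -/

lemma window_subset (R ℓ y : ℝ) :
    {t : ℝ | |t - y| ≤ ℓ ∧ |t| ≤ R} ⊆ {t : ℝ | |t| ≤ R} := fun _ ht => ht.2

/-- A uniform bound on `[-R, R]`, cruder than averaging over windows but free of any upper bound on
the density: `1/a` may be locally unbounded. -/
lemma LocallyAC.enorm_sq_le_of_abs_le {g : ℝ → ℝ} (hg : LocallyAC g) {R ℓ y : ℝ} (hℓ : 0 < ℓ)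
    (hℓR : ℓ ≤ R) (hy : |y| ≤ R) : ‖g y‖ₑ ^ 2 ≤
      2 * ENNReal.ofReal ℓ⁻¹ ^ 2 * (∫⁻ t in {t : ℝ | |t| ≤ R}, ‖g t‖ₑ) ^ 2 +
        4 * ENNReal.ofReal ℓ * ∫⁻ t, ‖deriv g t‖ₑ ^ 2 := by
  refine (hg.enorm_sq_le hℓ hℓR hy).trans ?_
  gcongr
  · exact fun ht => ht.2
  · exact Measure.restrict_le_self

/-- Estimate of the `L²(μ)`-norm outside `[-R, R]` by comparison with the boundary values. -/
lemma LocallyAC.lintegral_outer_sq_le {a g : ℝ → ℝ} [IsProbabilityMeasure (mu a)]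
    (hg : LocallyAC g) {R ℓ : ℝ} (hℓ : 0 < ℓ) (hℓR : ℓ ≤ R) {B : ℝ≥0∞}
    (hB : ∀ x : ℝ, ‖x‖ₑ * (mu a).restrict {x : ℝ | |x| ≤ R}ᶜ {s : ℝ | |x| ≤ |s|} ≤ B) :
    ∫⁻ x in {x : ℝ | |x| ≤ R}ᶜ, ‖g x‖ₑ ^ 2 ∂(mu a) ≤
      16 * B * (∫⁻ t, ‖deriv g t‖ₑ ^ 2) + 2 * mu a {x : ℝ | |x| ≤ R}ᶜ *
        (2 * ENNReal.ofReal ℓ⁻¹ ^ 2 * (∫⁻ t in {t : ℝ | |t| ≤ R}, ‖g t‖ₑ) ^ 2 +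
          4 * ENNReal.ofReal ℓ * ∫⁻ t, ‖deriv g t‖ₑ ^ 2) := by
  set Q := 2 * ENNReal.ofReal ℓ⁻¹ ^ 2 * (∫⁻ t in {t : ℝ | |t| ≤ R}, ‖g t‖ₑ) ^ 2 +
          4 * ENNReal.ofReal ℓ * ∫⁻ t, ‖deriv g t‖ₑ ^ 2 with hQ
  have hmS : MeasurableSet {x : ℝ | |x| ≤ R}ᶜ := (measurableSet_abs_le R).compl
  have h1 (x : ℝ) (hx : x ∈ {x : ℝ | |x| ≤ R}ᶜ) :
      ‖g x‖ₑ ^ 2 ≤ 2 * (∫⁻ t in {t : ℝ | |t| ≤ |x|}, ‖deriv g t‖ₑ) ^ 2 + 2 * Q := by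
    have hx' : R < |x| := not_le.1 hx
    have hR : 0 < R := hℓ.trans_le hℓR
    -- The single point `R` serves both half-lines: for `x < -R` the segment from `x` to `R` still
    -- lies in `[-|x|, |x|]`.
    have hRx : Set.uIcc x R ⊆ {t : ℝ | |t| ≤ |x|} := by
      have hI : {t : ℝ | |t| ≤ |x|} = Set.Icc (-|x|) |x| := by ext t; simp [abs_le]
      rw [hI]
      exact Set.ordConnected_Icc.uIcc_subset ⟨neg_abs_le x, le_abs_self x⟩
        ⟨by linarith, hx'.le⟩
    calc ‖g x‖ₑ ^ 2 = ‖(g x - g R) + g R‖ₑ ^ 2 := by congr 2; ring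
      _ ≤ (‖g x - g R‖ₑ + ‖g R‖ₑ) ^ 2 := by gcongr; exact enorm_add_le _ _
      _ ≤ 2 * ‖g x - g R‖ₑ ^ 2 + 2 * ‖g R‖ₑ ^ 2 := ennreal_add_sq_le _ _
      _ ≤ _ := by
        gcongr
        · exact hg.enorm_sub_le hRx
        · exact hg.enorm_sq_le_of_abs_le hℓ hℓR (abs_of_pos hR).le
  calc _ ≤ ∫⁻ x in {x : ℝ | |x| ≤ R}ᶜ,
        (2 * (∫⁻ t in {t : ℝ | |t| ≤ |x|}, ‖deriv g t‖ₑ) ^ 2 + 2 * Q) ∂(mu a) :=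
        setLIntegral_mono' hmS h1
    _ = 2 * ∫⁻ x in {x : ℝ | |x| ≤ R}ᶜ, (∫⁻ t in {t : ℝ | |t| ≤ |x|}, ‖deriv g t‖ₑ) ^ 2 ∂(mu a) +
        2 * Q * mu a {x : ℝ | |x| ≤ R}ᶜ := by
        rw [lintegral_add_right _ measurable_const, setLIntegral_const,
          lintegral_const_mul' _ _ (by norm_num)]
    _ ≤ 2 * (8 * B * ∫⁻ t, ‖deriv g t‖ₑ ^ 2) + 2 * Q * mu a {x : ℝ | |x| ≤ R}ᶜ := by
        gcongr
        exact hardy hB (measurable_enorm_deriv g)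
    _ = _ := by ring

/-- On a ball where the density is bounded below, `L¹(dx)` is controlled by `L¹(μ)`. -/
lemma setLIntegral_le_of_le_density {a : ℝ → ℝ} (ha : Measurable a) {g : ℝ → ℝ}
    (hg : Continuous g) {R k : ℝ} (hk : 0 < k) (h : ∀ x : ℝ, |x| ≤ R → k ≤ (a x)⁻¹) :
    ∫⁻ t in {t : ℝ | |t| ≤ R}, ‖g t‖ₑ ≤ ENNReal.ofReal k⁻¹ * ∫⁻ t, ‖g t‖ₑ ∂(mu a) := by
  have hw := measurable_ofReal_inv ha
  have hgm : Measurable fun t => ‖g t‖ₑ := hg.measurable.enorm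
  calc _ ≤ ∫⁻ t in {t : ℝ | |t| ≤ R}, ENNReal.ofReal k⁻¹ * (ENNReal.ofReal (a t)⁻¹ * ‖g t‖ₑ) := by
        refine setLIntegral_mono' (measurableSet_abs_le R) fun t ht => ?_
        rw [← mul_assoc, ← ENNReal.ofReal_mul (by positivity)]
        refine le_mul_of_one_le_left zero_le ?_
        rw [ENNReal.one_le_ofReal, inv_mul_eq_div, one_le_div hk]
        exact h t ht
    _ ≤ ∫⁻ t, ENNReal.ofReal k⁻¹ * (ENNReal.ofReal (a t)⁻¹ * ‖g t‖ₑ) :=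
        setLIntegral_le_lintegral _ _
    _ = _ := by
        rw [lintegral_const_mul' _ _ ENNReal.ofReal_ne_top, mu,
          lintegral_withDensity_eq_lintegral_mul _ hw hgm]
        rfl

/-- Inside `|x| ≤ R` the restricted tail lies in `|s| ≥ R`, so the bound at `R` applies there as
well. -/
lemma restrict_tail_le_of_tail_le {a : ℝ → ℝ} {R : ℝ} (hR : 0 < R) {ε : ℝ≥0∞}
    (h : ∀ x : ℝ, R ≤ |x| → ‖x‖ₑ * mu a {s : ℝ | |x| ≤ |s|} ≤ ε) (x : ℝ) :
    ‖x‖ₑ * (mu a).restrict {x : ℝ | |x| ≤ R}ᶜ {s : ℝ | |x| ≤ |s|} ≤ ε := by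
  rcases le_total R |x| with hx | hx
  · refine le_trans ?_ (h x hx)
    gcongr
    exact Measure.restrict_le_self
  · refine le_trans ?_ (h R (le_abs_self R))
    rw [Measure.restrict_apply (measurableSet_le_abs _), Real.enorm_eq_ofReal_abs,
      Real.enorm_eq_ofReal_abs, abs_of_pos hR]
    gcongr
    intro s hs
    exact (not_le.1 (show ¬ |s| ≤ R from hs.2)).le

/-- For vanishing tails, a super Poincaré inequality holds with some finite rate. -/
lemma exists_superPoincare {a : ℝ → ℝ} (ha : Measurable a) (ha_pos : ∀ x, 0 < a x)
    (ha_bdd : ∀ R : ℝ, ∃ M : ℝ, ∀ x : ℝ, |x| ≤ R → a x ≤ M) [IsProbabilityMeasure (mu a)]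
    (h : tailLimsup a = 0) :
    ∃ β : ℝ → ℝ, (∀ r, 0 < r → 0 < β r) ∧ SuperPoincare a (fun r => ENNReal.ofReal (β r)) := by
  suffices H : ∀ r : ℝ, ∃ b : ℝ, 0 < b ∧ (0 < r → ∀ f : ℝ → ℝ, InDomain a f →
      ∫⁻ x, ‖f x‖ₑ ^ 2 ∂(mu a) ≤
        ENNReal.ofReal r * energy f + ENNReal.ofReal b * (∫⁻ x, ‖f x‖ₑ ∂(mu a)) ^ 2) by
    choose β hβ0 hβ using H
    exact ⟨β, fun r _ => hβ0 r, fun r hr f hf => hβ r hr f hf⟩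
  intro r
  rcases le_or_gt r 0 with hr | hr
  · exact ⟨1, one_pos, fun h => absurd h (not_lt.2 hr)⟩
  rw [tailLimsup_eq] at h
  -- Each choice uses half of `r`: the Hardy term costs `32 · r/64` and the window terms `24 ℓ ≤ 24
  -- · r/48`, both after `∫ g'² = 2 𝓔`.
  obtain ⟨R, hR, hRt⟩ := eventually_cocompact_real.1 (eventually_lt_of_limsup_lt
    (h.trans_lt (ENNReal.ofReal_pos.2 (show 0 < r / 64 by positivity))))
  obtain ⟨M', hM'⟩ := ha_bdd R
  set M := max M' 1 with hM
  have hM0 : 0 < M := lt_max_of_lt_right one_pos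
  have hk : ∀ x : ℝ, |x| ≤ R → M⁻¹ ≤ (a x)⁻¹ := fun x hx =>
    inv_anti₀ (ha_pos x) ((hM' x hx).trans (le_max_left _ _))
  set ℓ := min R (r / 48) with hℓ
  have hℓ0 : 0 < ℓ := lt_min hR (by positivity)
  refine ⟨6 * ℓ⁻¹ ^ 2 * M ^ 2, by positivity, fun _ f hf => ?_⟩
  obtain ⟨g, hg, hfg, hD⟩ := hf.exists_locallyAC
  rw [lintegral_congr_ae (hfg.mono fun x hx => by simp only [hx] :
      (fun x => ‖f x‖ₑ) =ᵐ[mu a] fun x => ‖g x‖ₑ),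
    lintegral_congr_ae (hfg.mono fun x hx => by simp only [hx] :
      (fun x => ‖f x‖ₑ ^ 2) =ᵐ[mu a] fun x => ‖g x‖ₑ ^ 2)]
  set Q := 2 * ENNReal.ofReal ℓ⁻¹ ^ 2 * (∫⁻ t in {t : ℝ | |t| ≤ R}, ‖g t‖ₑ) ^ 2 +
          4 * ENNReal.ofReal ℓ * ∫⁻ t, ‖deriv g t‖ₑ ^ 2 with hQ
  have hin : ∫⁻ x in {x : ℝ | |x| ≤ R}, ‖g x‖ₑ ^ 2 ∂(mu a) ≤ Q := by
    calc _ ≤ ∫⁻ x in {x : ℝ | |x| ≤ R}, Q ∂(mu a) :=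
          setLIntegral_mono' (measurableSet_abs_le R) fun x hx =>
            hg.enorm_sq_le_of_abs_le hℓ0 (min_le_left _ _) hx
      _ = Q * mu a {x : ℝ | |x| ≤ R} := setLIntegral_const _ _
      _ ≤ Q * 1 := by gcongr; exact prob_le_one
      _ = Q := mul_one Q
  have hout := hg.lintegral_outer_sq_le hℓ0 (min_le_left _ _)
    (restrict_tail_le_of_tail_le hR fun x hx => (hRt x hx).le)
  rw [← hQ] at hout
  have hA := setLIntegral_le_of_le_density ha hg.continuous (inv_pos.2 hM0) hk
  rw [inv_inv] at hA
  rw [← lintegral_add_compl _ (measurableSet_abs_le R)]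
  calc _ ≤ Q + (16 * ENNReal.ofReal (r / 64) * (∫⁻ t, ‖deriv g t‖ₑ ^ 2) + 2 * 1 * Q) := by
        refine add_le_add hin (hout.trans ?_)
        gcongr
        exact prob_le_one
    _ = (32 * ENNReal.ofReal (r / 64) + 24 * ENNReal.ofReal ℓ) * energy f +
        6 * ENNReal.ofReal ℓ⁻¹ ^ 2 * (∫⁻ t in {t : ℝ | |t| ≤ R}, ‖g t‖ₑ) ^ 2 := by
        rw [hQ, hD]; ring
    _ ≤ (32 * ENNReal.ofReal (r / 64) + 24 * ENNReal.ofReal (r / 48)) * energy f +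
        6 * ENNReal.ofReal ℓ⁻¹ ^ 2 * (ENNReal.ofReal M * ∫⁻ t, ‖g t‖ₑ ∂(mu a)) ^ 2 := by
        gcongr
        exact min_le_right _ _
    _ = _ := by
        have e1 : (32 : ℝ≥0∞) * ENNReal.ofReal (r / 64) + 24 * ENNReal.ofReal (r / 48) =
            ENNReal.ofReal r := by
          rw [← ENNReal.ofReal_ofNat 32, ← ENNReal.ofReal_ofNat 24,
            ← ENNReal.ofReal_mul (by norm_num), ← ENNReal.ofReal_mul (by norm_num),
            ← ENNReal.ofReal_add (by positivity) (by positivity)]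
          congr 1; ring
        have e2 : ENNReal.ofReal (6 * ℓ⁻¹ ^ 2 * M ^ 2) =
            6 * ENNReal.ofReal ℓ⁻¹ ^ 2 * ENNReal.ofReal M ^ 2 := by
          rw [ENNReal.ofReal_mul (by positivity), ENNReal.ofReal_mul (by norm_num),
            ENNReal.ofReal_pow (by positivity), ENNReal.ofReal_pow (by positivity),
            ENNReal.ofReal_ofNat]
        rw [e1, e2]; ring

/-! ### Estimates under two-sided density bounds -/

/-- Double integration over moving windows. -/
lemma lintegral_window_le {F : ℝ → ℝ≥0∞} (hF : Measurable F) (R ℓ : ℝ) :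
    ∫⁻ y in {y : ℝ | |y| ≤ R}, ∫⁻ t in {t : ℝ | |t - y| ≤ ℓ ∧ |t| ≤ R}, F t ≤
      2 * ENNReal.ofReal ℓ * ∫⁻ t in {t : ℝ | |t| ≤ R}, F t := by
  have hm : MeasurableSet {q : ℝ × ℝ | |q.2 - q.1| ≤ ℓ ∧ |q.2| ≤ R} :=
    (measurableSet_le (f := fun q : ℝ × ℝ => |q.2 - q.1|) (by fun_prop) measurable_const).inter
      (measurableSet_le (f := fun q : ℝ × ℝ => |q.2|) (by fun_prop) measurable_const)
  calc _ ≤ ∫⁻ y, ∫⁻ t in {t : ℝ | |t - y| ≤ ℓ ∧ |t| ≤ R}, F t := setLIntegral_le_lintegral _ _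
    _ = ∫⁻ y, ∫⁻ t, {q : ℝ × ℝ | |q.2 - q.1| ≤ ℓ ∧ |q.2| ≤ R}.indicator (fun q => F q.2) (y, t) := by
        refine lintegral_congr fun y => ?_
        rw [← lintegral_indicator (measurableSet_window R ℓ y)]
        rfl
    _ = ∫⁻ t, ∫⁻ y, {q : ℝ × ℝ | |q.2 - q.1| ≤ ℓ ∧ |q.2| ≤ R}.indicator (fun q => F q.2) (y, t) :=
        lintegral_lintegral_swap
          (Measurable.indicator (by fun_prop) hm).aemeasurable
    _ ≤ ∫⁻ t, {t : ℝ | |t| ≤ R}.indicator (fun t => 2 * ENNReal.ofReal ℓ * F t) t := by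
        refine lintegral_mono fun t => ?_
        by_cases ht : |t| ≤ R
        · rw [Set.indicator_of_mem (show t ∈ {t : ℝ | |t| ≤ R} from ht)]
          calc _ ≤ ∫⁻ y, (Metric.closedBall t ℓ).indicator (fun _ => F t) y := by
                refine lintegral_mono fun y => ?_
                simp only [Set.indicator, Set.mem_ofPred_eq, Metric.mem_closedBall, Real.dist_eq,
                  ht, and_true, abs_sub_comm t y]
                rfl
            _ = F t * volume (Metric.closedBall t ℓ) :=
                lintegral_indicator_const measurableSet_closedBall _
            _ = _ := by
                rw [Real.volume_closedBall, ENNReal.ofReal_mul (by norm_num)]; simp; ring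
        · simp [Set.indicator, ht]
    _ = _ := by
        rw [lintegral_indicator (measurableSet_abs_le R), lintegral_const_mul _ hF]

/-- Local super Poincaré estimate on `[-R, R]`, where the density of `μ` is at most `K`. -/
lemma LocallyAC.lintegral_inner_sq_le {a g : ℝ → ℝ} (ha : Measurable a) (hg : LocallyAC g)
    {R ℓ : ℝ} (hℓ : 0 < ℓ) (hℓR : ℓ ≤ R) {K : ℝ≥0∞}
    (hK : ∀ x : ℝ, |x| ≤ R → ENNReal.ofReal (a x)⁻¹ ≤ K) :
    ∫⁻ x in {x : ℝ | |x| ≤ R}, ‖g x‖ₑ ^ 2 ∂(mu a) ≤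
      K * (4 * ENNReal.ofReal ℓ⁻¹ * (∫⁻ t in {t : ℝ | |t| ≤ R}, ‖g t‖ₑ) ^ 2 +
        8 * ENNReal.ofReal ℓ ^ 2 * ∫⁻ t, ‖deriv g t‖ₑ ^ 2) := by
  have hw := measurable_ofReal_inv ha
  have hgm : Measurable fun t => ‖g t‖ₑ := hg.continuous.measurable.enorm
  have hgm2 : Measurable fun t => ‖g t‖ₑ ^ 2 := hgm.pow_const 2
  have hdm : Measurable fun t => ‖deriv g t‖ₑ ^ 2 := (measurable_enorm_deriv g).pow_const 2
  have hI := measurableSet_abs_le R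
  have hwin {F : ℝ → ℝ≥0∞} (hF : Measurable F) :
      Measurable fun y : ℝ => ∫⁻ t in {t : ℝ | |t - y| ≤ ℓ ∧ |t| ≤ R}, F t := by
    have hm : MeasurableSet {q : ℝ × ℝ | |q.2 - q.1| ≤ ℓ ∧ |q.2| ≤ R} :=
      (measurableSet_le (f := fun q : ℝ × ℝ => |q.2 - q.1|) (by fun_prop) measurable_const).inter
        (measurableSet_le (f := fun q : ℝ × ℝ => |q.2|) (by fun_prop) measurable_const)
    have := (Measurable.indicator (f := fun q : ℝ × ℝ => F q.2) (by fun_prop) hm).lintegral_prod_right'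
      (ν := volume)
    convert! this using 2 with y
    rw [← lintegral_indicator (measurableSet_window R ℓ y)]
    rfl
  set A := ∫⁻ t in {t : ℝ | |t| ≤ R}, ‖g t‖ₑ with hA
  set D := ∫⁻ t, ‖deriv g t‖ₑ ^ 2 with hD
  calc _ = ∫⁻ x in {x : ℝ | |x| ≤ R}, ENNReal.ofReal (a x)⁻¹ * ‖g x‖ₑ ^ 2 := by
        rw [mu, setLIntegral_withDensity_eq_setLIntegral_mul _ hw hgm2 hI]
        rfl
    _ ≤ ∫⁻ x in {x : ℝ | |x| ≤ R}, K * ‖g x‖ₑ ^ 2 :=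
        setLIntegral_mono' hI fun x hx => by gcongr; exact hK x hx
    _ = K * ∫⁻ x in {x : ℝ | |x| ≤ R}, ‖g x‖ₑ ^ 2 := lintegral_const_mul _ hgm2
    _ ≤ K * ∫⁻ y in {y : ℝ | |y| ≤ R},
        (2 * ENNReal.ofReal ℓ⁻¹ ^ 2 * A * (∫⁻ t in {t : ℝ | |t - y| ≤ ℓ ∧ |t| ≤ R}, ‖g t‖ₑ) +
        4 * ENNReal.ofReal ℓ * ∫⁻ t in {t : ℝ | |t - y| ≤ ℓ ∧ |t| ≤ R}, ‖deriv g t‖ₑ ^ 2) := by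
        gcongr K * ?_
        refine setLIntegral_mono' hI fun y hy => (hg.enorm_sq_le hℓ hℓR hy).trans ?_
        -- Only one of the two window integrals of `|g|` is enlarged to `A`. Integrating the other
        -- over `y` gains a factor `2ℓ`, so the final price is `ℓ⁻¹` instead of `ℓ⁻²`; this yields
        -- the exponent `-1/2` of `r` in the rate.
        rw [sq (∫⁻ t in _, ‖g t‖ₑ), mul_assoc (_ * _) A]
        gcongr
        exact lintegral_mono_set (window_subset R ℓ y)
    _ = K * (2 * ENNReal.ofReal ℓ⁻¹ ^ 2 * A *
          (∫⁻ y in {y : ℝ | |y| ≤ R}, ∫⁻ t in {t : ℝ | |t - y| ≤ ℓ ∧ |t| ≤ R}, ‖g t‖ₑ) +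
        4 * ENNReal.ofReal ℓ *
          ∫⁻ y in {y : ℝ | |y| ≤ R}, ∫⁻ t in {t : ℝ | |t - y| ≤ ℓ ∧ |t| ≤ R}, ‖deriv g t‖ₑ ^ 2) := by
        rw [lintegral_add_left ((hwin hgm).const_mul _), lintegral_const_mul _ (hwin hgm),
          lintegral_const_mul _ (hwin hdm)]
    _ ≤ K * (2 * ENNReal.ofReal ℓ⁻¹ ^ 2 * A * (2 * ENNReal.ofReal ℓ * A) +
        4 * ENNReal.ofReal ℓ * (2 * ENNReal.ofReal ℓ * D)) := by
        gcongr
        · exact lintegral_window_le hgm R ℓ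
        · refine (lintegral_window_le hdm R ℓ).trans ?_
          gcongr
          exact setLIntegral_le_lintegral _ _
    _ = K * (4 * (ENNReal.ofReal ℓ⁻¹ * ENNReal.ofReal ℓ) * ENNReal.ofReal ℓ⁻¹ * A ^ 2 +
        8 * ENNReal.ofReal ℓ ^ 2 * D) := by ring
    _ = _ := by
        rw [← ENNReal.ofReal_mul (by positivity), inv_mul_cancel₀ hℓ.ne', ENNReal.ofReal_one,
          mul_one]

/-- Quantitative form: a bound of the density of `μ` on `[-R, R]` from both sides and a decay
`c (1 + |x|)⁻²` outside give a defective Poincaré inequality. -/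
lemma LocallyAC.lintegral_sq_le_of_density {a g : ℝ → ℝ} (ha : Measurable a)
    [IsProbabilityMeasure (mu a)] (hg : LocallyAC g) {R ℓ K k c : ℝ} (hℓ : 0 < ℓ) (hℓR : ℓ ≤ R)
    (hk : 0 < k) (hc : 0 < c) (hkK : ∀ x : ℝ, |x| ≤ R → k ≤ (a x)⁻¹ ∧ (a x)⁻¹ ≤ K)
    (hdecay : ∀ x : ℝ, R < |x| →
      ENNReal.ofReal (a x)⁻¹ ≤ ENNReal.ofReal c * ENNReal.ofReal (((1 + |x|) ^ 2)⁻¹)) :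
    ∫⁻ x, ‖g x‖ₑ ^ 2 ∂(mu a) ≤
      ENNReal.ofReal (8 * K * ℓ ^ 2 + 32 * c + 16 * c * ℓ) * (∫⁻ t, ‖deriv g t‖ₑ ^ 2) +
      ENNReal.ofReal ((4 * K / ℓ + 8 * c / ℓ ^ 2) / k ^ 2) * (∫⁻ t, ‖g t‖ₑ ∂(mu a)) ^ 2 := by
  have hR : 0 < R := hℓ.trans_le hℓR
  have hK : 0 < K := by
    have := hkK 0 (by simpa using hR.le)
    linarith
  have hmS : MeasurableSet {x : ℝ | |x| ≤ R}ᶜ := (measurableSet_abs_le R).compl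
  have hdecay' : ∀ x ∈ {x : ℝ | |x| ≤ R}ᶜ,
      ENNReal.ofReal (a x)⁻¹ ≤ ENNReal.ofReal c * ENNReal.ofReal (((1 + |x|) ^ 2)⁻¹) :=
    fun x hx => hdecay x (not_le.1 (show ¬ |x| ≤ R from hx))
  have hin := hg.lintegral_inner_sq_le ha hℓ hℓR
    (fun x hx => ENNReal.ofReal_le_ofReal (hkK x hx).2)
  have hout := hg.lintegral_outer_sq_le hℓ hℓR (enorm_mul_restrict_tail_le hmS hdecay')
  have hN := restrict_univ_le hmS hdecay'
  have hA := setLIntegral_le_of_le_density ha hg.continuous hk fun x hx => (hkK x hx).1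
  set A := ∫⁻ t in {t : ℝ | |t| ≤ R}, ‖g t‖ₑ
  set D := ∫⁻ t, ‖deriv g t‖ₑ ^ 2
  set m := ∫⁻ t, ‖g t‖ₑ ∂(mu a)
  rw [← lintegral_add_compl _ (measurableSet_abs_le R)]
  calc _ ≤ ENNReal.ofReal K * (4 * ENNReal.ofReal ℓ⁻¹ * (ENNReal.ofReal k⁻¹ * m) ^ 2 +
          8 * ENNReal.ofReal ℓ ^ 2 * D) +
        (16 * (2 * ENNReal.ofReal c) * D + 2 * (2 * ENNReal.ofReal c) *
          (2 * ENNReal.ofReal ℓ⁻¹ ^ 2 * (ENNReal.ofReal k⁻¹ * m) ^ 2 +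
            4 * ENNReal.ofReal ℓ * D)) := by
        refine add_le_add (hin.trans ?_) (hout.trans ?_) <;> gcongr
    _ = (8 * ENNReal.ofReal K * ENNReal.ofReal ℓ ^ 2 + 32 * ENNReal.ofReal c +
          16 * ENNReal.ofReal c * ENNReal.ofReal ℓ) * D +
        ((4 * ENNReal.ofReal K * ENNReal.ofReal ℓ⁻¹ +
          8 * ENNReal.ofReal c * ENNReal.ofReal ℓ⁻¹ ^ 2) * ENNReal.ofReal k⁻¹ ^ 2) * m ^ 2 := by
        ring
    _ = _ := by
        have e1 : ENNReal.ofReal (8 * K * ℓ ^ 2 + 32 * c + 16 * c * ℓ) =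
            8 * ENNReal.ofReal K * ENNReal.ofReal ℓ ^ 2 + 32 * ENNReal.ofReal c +
              16 * ENNReal.ofReal c * ENNReal.ofReal ℓ := by
          rw [ENNReal.ofReal_add (by positivity) (by positivity),
            ENNReal.ofReal_add (by positivity) (by positivity),
            ENNReal.ofReal_mul (by positivity), ENNReal.ofReal_mul (by positivity),
            ENNReal.ofReal_mul (by positivity), ENNReal.ofReal_mul (by positivity),
            ENNReal.ofReal_mul (by positivity), ENNReal.ofReal_pow (by positivity)]
          simp only [ENNReal.ofReal_ofNat]
        have e2 : ENNReal.ofReal ((4 * K / ℓ + 8 * c / ℓ ^ 2) / k ^ 2) =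
            (4 * ENNReal.ofReal K * ENNReal.ofReal ℓ⁻¹ +
              8 * ENNReal.ofReal c * ENNReal.ofReal ℓ⁻¹ ^ 2) * ENNReal.ofReal k⁻¹ ^ 2 := by
          rw [show (4 * K / ℓ + 8 * c / ℓ ^ 2) / k ^ 2 =
              (4 * K * ℓ⁻¹ + 8 * c * ℓ⁻¹ ^ 2) * k⁻¹ ^ 2 by field_simp,
            ENNReal.ofReal_mul (by positivity),
            ENNReal.ofReal_add (by positivity) (by positivity),
            ENNReal.ofReal_mul (by positivity), ENNReal.ofReal_mul (by positivity),
            ENNReal.ofReal_mul (by positivity), ENNReal.ofReal_mul (by positivity),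
            ENNReal.ofReal_pow (by positivity), ENNReal.ofReal_pow (by positivity)]
          simp only [ENNReal.ofReal_ofNat]
        rw [e1, e2]

/-! ### Super Poincaré with the explicit rate -/

lemma bigK_ne_zero {a : ℝ → ℝ} (ha_pos : ∀ x, 0 < a x) (r : ℝ≥0∞) : bigK a r ≠ 0 := by
  refine (lt_of_lt_of_le (ENNReal.ofReal_pos.2 (inv_pos.2 (ha_pos 0))) ?_).ne'
  exact le_iSup₂_of_le (f := fun (x : ℝ) (_ : ‖x‖ₑ ≤ r) => ENNReal.ofReal (a x)⁻¹) 0 (by simp) le_rfl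

lemma smallK_ne_top (a : ℝ → ℝ) (r : ℝ≥0∞) : smallK a r ≠ ∞ :=
  ((iInf₂_le (0 : ℝ) (by simp)).trans_lt ENNReal.ofReal_lt_top).ne

/-- A positive lower bound for the density on all of `ℝ` would contradict its total mass 1. This
makes the convention `K₀(∞) = ∞` a consequence of the formula. -/
lemma smallK_top (a : ℝ → ℝ) [IsProbabilityMeasure (mu a)] : smallK a ∞ = 0 := by
  by_contra h
  have h1 : ∫⁻ _ : ℝ, smallK a ∞ ≤ ∫⁻ x, ENNReal.ofReal (a x)⁻¹ :=
    lintegral_mono fun x => iInf₂_le x le_top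
  have h2 : ∫⁻ x, ENNReal.ofReal (a x)⁻¹ = 1 := by
    have := mu_apply a MeasurableSet.univ
    rw [Measure.restrict_univ] at this
    rw [← this, measure_univ]
  rw [lintegral_const, Real.volume_univ, ENNReal.mul_top h, h2] at h1
  exact absurd h1 (by simp)

lemma K0_top {a : ℝ → ℝ} (ha_pos : ∀ x, 0 < a x) [IsProbabilityMeasure (mu a)] :
    K0 a ∞ = ∞ := by
  rw [K0, smallK_top, zero_pow two_ne_zero, ENNReal.div_zero]
  exact fun h => bigK_ne_zero ha_pos ∞ ((ENNReal.rpow_eq_zero_iff_of_pos (by norm_num)).1 h)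

lemma K0_eq_top_of_bigK {a : ℝ → ℝ} {r : ℝ≥0∞} (h : bigK a r = ∞) : K0 a r = ∞ := by
  rw [K0, h, ENNReal.top_rpow_of_pos (by norm_num)]
  exact ENNReal.top_div_of_ne_top (ENNReal.pow_ne_top (smallK_ne_top a r))

lemma smallK_pos {a : ℝ → ℝ} (ha_pos : ∀ x, 0 < a x)
    (ha_bdd : ∀ R : ℝ, ∃ M : ℝ, ∀ x : ℝ, |x| ≤ R → a x ≤ M) {r : ℝ≥0∞} (hr : r ≠ ∞) :
    0 < smallK a r := by
  obtain ⟨M, hM⟩ := ha_bdd r.toReal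
  have hM0 : 0 < M := (ha_pos 0).trans_le (hM 0 (by simp))
  refine lt_of_lt_of_le (ENNReal.ofReal_pos.2 (inv_pos.2 hM0)) (le_iInf₂ fun x hx => ?_)
  refine ENNReal.ofReal_le_ofReal (inv_anti₀ (ha_pos x) (hM x ?_))
  rw [Real.enorm_eq_ofReal_abs] at hx
  exact (ENNReal.ofReal_le_iff_le_toReal hr).1 hx

/-- The infimum defining `PhiInv` need not be attained, so the decay is claimed only strictly beyond
it. -/
lemma density_decay_of_PhiInv_lt {a : ℝ → ℝ} (ha_pos : ∀ x, 0 < a x) {t : ℝ≥0∞} {x : ℝ}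
    (hx : PhiInv a t < ‖x‖ₑ) :
    ENNReal.ofReal (a x)⁻¹ ≤ t⁻¹ * ENNReal.ofReal (((1 + |x|) ^ 2)⁻¹) := by
  obtain ⟨s, hs, hsx⟩ := sInf_lt_iff.1 hx
  exact ofReal_inv_le_of_le (ha_pos x) (le_trans hs (iInf₂_le x hsx.le))

lemma superRate_eq_top {a : ℝ → ℝ} {C₁ C₂ r : ℝ} (hC₁ : 0 < C₁) (hr : 0 < r)
    (h : K0 a (PhiInv a (ENNReal.ofReal (C₂ / r))) = ∞) : superRate a C₁ C₂ r = ∞ := by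
  rw [superRate, h, ENNReal.mul_top (ENNReal.ofReal_pos.2 (Real.rpow_pos_of_pos hr _)).ne',
    add_top, ENNReal.mul_top (ENNReal.ofReal_pos.2 hC₁).ne']

/-- Void rates need an argument because `∞ * 0 = 0`: if the `L¹` norm vanishes, so does `f` almost
everywhere. -/
lemma lintegral_sq_le_top_mul {a f : ℝ → ℝ} (hf : InDomain a f) :
    ∫⁻ x, ‖f x‖ₑ ^ 2 ∂(mu a) ≤ ∞ * (∫⁻ x, ‖f x‖ₑ ∂(mu a)) ^ 2 := by
  by_cases h : ∫⁻ x, ‖f x‖ₑ ∂(mu a) = 0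
  · have h0 := (lintegral_eq_zero_iff' hf.1.aestronglyMeasurable.enorm).1 h
    have : ∫⁻ x, ‖f x‖ₑ ^ 2 ∂(mu a) = ∫⁻ _, 0 ∂(mu a) :=
      lintegral_congr_ae (h0.mono fun x hx => by
        simp only [Pi.zero_apply] at hx
        simp [hx])
    simp [this]
  · rw [ENNReal.top_mul (pow_ne_zero 2 h)]
    exact le_top

/-- Absolute continuity of `μ`: small intervals have small mass. The resulting `ρ` will bound the
cut-off radius from below. -/
lemma exists_mu_closed_ball_lt (a : ℝ → ℝ) [IsProbabilityMeasure (mu a)] :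
    ∃ ρ : ℝ, 0 < ρ ∧ mu a {x : ℝ | |x| ≤ ρ} < 2⁻¹ := by
  have hfin : ∫⁻ x, ENNReal.ofReal (a x)⁻¹ ≠ ∞ := by
    have := mu_apply a MeasurableSet.univ
    rw [Measure.restrict_univ] at this
    rw [← this]
    exact measure_ne_top _ _
  have hvol (ρ : ℝ) : volume {x : ℝ | |x| ≤ ρ} = ENNReal.ofReal (2 * ρ) := by
    rw [← Real.volume_closedBall (0 : ℝ) ρ]
    congr 1
    ext x
    simp
  have hlim : Tendsto (volume ∘ fun ρ : ℝ => {x : ℝ | |x| ≤ ρ}) (𝓝[>] 0) (𝓝 0) := by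
    have h1 : Continuous fun ρ : ℝ => ENNReal.ofReal (2 * ρ) :=
      ENNReal.continuous_ofReal.comp (continuous_const_mul 2)
    have h2 := (h1.tendsto 0).mono_left (nhdsWithin_le_nhds (s := Set.Ioi 0))
    simp only [mul_zero, ENNReal.ofReal_zero] at h2
    exact h2.congr fun ρ => (hvol ρ).symm
  have h := tendsto_setLIntegral_zero hfin hlim
  obtain ⟨ρ, h1, h2⟩ := ((h.eventually_lt_const (show (0 : ℝ≥0∞) < 2⁻¹ by simp)).and
    self_mem_nhdsWithin).exists
  exact ⟨ρ, h2, by rwa [mu_apply a (measurableSet_abs_le ρ)]⟩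

/-- The super Poincaré inequality with the explicit rate. -/
lemma exists_superPoincare_superRate {a : ℝ → ℝ} (ha : Measurable a) (ha_pos : ∀ x, 0 < a x)
    (ha_bdd : ∀ R : ℝ, ∃ M : ℝ, ∀ x : ℝ, |x| ≤ R → a x ≤ M) [IsProbabilityMeasure (mu a)]
    {r₀ : ℝ} (hr₀ : 0 < r₀) (hP : Poincare a r₀) :
    ∃ C₁ C₂ : ℝ, 0 < C₁ ∧ 0 < C₂ ∧ SuperPoincare a (superRate a C₁ C₂) := by
  obtain ⟨ρ, hρ, hρμ⟩ := exists_mu_closed_ball_lt a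
  set Q := √(r₀ * a 0) with hQ
  have hQ0 : 0 < Q := Real.sqrt_pos.2 (mul_pos hr₀ (ha_pos 0))
  -- With `ℓ = ε q`, where `q = √(r/K) ≤ Q`, the bound `1/6` keeps `16 K ℓ²` below `4r/9`, and the
  -- other one gives `ℓ ≤ min ρ 1`.
  set ε := min (1 / 6) (min ρ 1 / Q) with hε
  have hε0 : 0 < ε := by positivity
  have hε6 : ε ≤ 1 / 6 := min_le_left _ _
  have hεQ : ε * Q ≤ min ρ 1 := (le_div_iff₀ hQ0).1 (min_le_right _ _)
  -- The summand `1` serves `r ≥ r₀`, `4/ε` the inner term and `Q/ε²` the outer term.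
  set C₁ := 1 + 4 / ε + Q / ε ^ 2 with hC₁
  have hC₁0 : 0 < C₁ := by positivity
  -- For `c = r / C₂`, the `192` makes the outer energy terms at most `96 c ≤ r/2`, and `4 r₀` makes
  -- the mass outside `[-R, R]`, at most `2c`, no more than `1/2` when `r < r₀`.
  set C₂ := 192 + 4 * r₀ with hC₂
  have hC₂0 : 0 < C₂ := by positivity
  refine ⟨C₁, C₂, hC₁0, hC₂0, fun r hr f hf => ?_⟩
  -- For large `r` the Poincaré inequality already suffices, as the rate is at least 1.
  rcases le_or_gt r₀ r with hr0 | hr0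
  · refine (hP.lintegral_sq_le hf).trans (add_le_add ?_ ?_)
    · gcongr
    · refine le_mul_of_one_le_left zero_le ?_
      rw [superRate]
      refine one_le_mul_of_one_le_of_one_le (ENNReal.one_le_ofReal.2 ?_) le_self_add
      have : 0 < 4 / ε := by positivity
      have : 0 < Q / ε ^ 2 := by positivity
      linarith
  set T := PhiInv a (ENNReal.ofReal (C₂ / r)) with hT
  by_cases hK0 : K0 a T = ∞
  · rw [superRate_eq_top hC₁0 hr hK0]
    exact (lintegral_sq_le_top_mul hf).trans le_add_self
  have hT_top : T ≠ ∞ := fun h => hK0 (by rw [h, K0_top ha_pos])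
  have hKtop : bigK a T ≠ ∞ := fun h => hK0 (K0_eq_top_of_bigK h)
  set R := T.toReal with hR
  set K := (bigK a T).toReal with hK
  set k := (smallK a T).toReal with hk
  have hk0 : 0 < k := ENNReal.toReal_pos (smallK_pos ha_pos ha_bdd hT_top).ne' (smallK_ne_top a T)
  have hK0' : 0 < K := ENNReal.toReal_pos (bigK_ne_zero ha_pos T) hKtop
  have henorm (x : ℝ) : ‖x‖ₑ ≤ T ↔ |x| ≤ R := by
    rw [Real.enorm_eq_ofReal_abs, ENNReal.ofReal_le_iff_le_toReal hT_top]
  have hkK : ∀ x : ℝ, |x| ≤ R → k ≤ (a x)⁻¹ ∧ (a x)⁻¹ ≤ K := by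
    intro x hx
    have hx' := (henorm x).2 hx
    have hw : 0 ≤ (a x)⁻¹ := (inv_pos.2 (ha_pos x)).le
    constructor
    · have : smallK a T ≤ ENNReal.ofReal (a x)⁻¹ := iInf₂_le x hx'
      exact ENNReal.toReal_le_of_le_ofReal hw this
    · have : ENNReal.ofReal (a x)⁻¹ ≤ bigK a T :=
        le_iSup₂_of_le (f := fun (x : ℝ) (_ : ‖x‖ₑ ≤ T) => ENNReal.ofReal (a x)⁻¹) x hx' le_rfl
      exact (ENNReal.ofReal_le_iff_le_toReal hKtop).1 this
  set c := r / C₂ with hc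
  have hc0 : 0 < c := by positivity
  have hdecay : ∀ x : ℝ, R < |x| →
      ENNReal.ofReal (a x)⁻¹ ≤ ENNReal.ofReal c * ENNReal.ofReal (((1 + |x|) ^ 2)⁻¹) := by
    intro x hx
    have hx' : T < ‖x‖ₑ := not_le.1 fun h => absurd ((henorm x).1 h) (not_le.2 hx)
    have := density_decay_of_PhiInv_lt ha_pos hx'
    rwa [← ENNReal.ofReal_inv_of_pos (by positivity), inv_div] at this
  -- Otherwise the decay would hold off `[-ρ, ρ]`, leaving mass at most `1/2` there and less than
  -- `1/2` inside. This gives `ℓ ≤ ρ ≤ R`.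
  have hρR : ρ ≤ R := by
    by_contra! hlt
    have h1 : mu a {x : ℝ | |x| ≤ ρ}ᶜ ≤ 2 * ENNReal.ofReal c :=
      restrict_univ_le (measurableSet_abs_le ρ).compl fun x hx =>
        hdecay x (hlt.trans (not_le.1 (show ¬ |x| ≤ ρ from hx)))
    have h2 : 2 * ENNReal.ofReal c ≤ 2⁻¹ := by
      rw [← ENNReal.ofReal_ofNat 2, ← ENNReal.ofReal_mul (by norm_num),
        ← ENNReal.ofReal_inv_of_pos (by norm_num)]
      refine ENNReal.ofReal_le_ofReal ?_
      rw [hc, mul_div_assoc', div_le_iff₀ hC₂0, hC₂]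
      linarith
    have h3 := prob_add_prob_compl (μ := mu a) (measurableSet_abs_le ρ)
    have h4 := ENNReal.add_lt_add_of_lt_of_le (ne_top_of_le_ne_top (by norm_num) (h1.trans h2))
      hρμ (h1.trans h2)
    rw [h3, ENNReal.inv_two_add_inv_two] at h4
    exact lt_irrefl _ h4
  set q := √(r / K) with hq
  have hq0 : 0 < q := Real.sqrt_pos.2 (by positivity)
  have hq2 : q ^ 2 = r / K := Real.sq_sqrt (by positivity)
  -- `K ≥ 1 / a 0` because `0` lies in `[-R, R]`. This bound, uniform in `r`, lets the outer `ℓ⁻²`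
  -- term be absorbed into `K / q`.
  have hqQ : q ≤ Q := by
    refine Real.sqrt_le_sqrt ?_
    have h0 := (hkK 0 (by simpa using hρ.le.trans hρR)).2
    calc r / K ≤ r₀ / K := by gcongr
      _ = r₀ * K⁻¹ := div_eq_mul_inv _ _
      _ ≤ r₀ * a 0 := by
        gcongr
        exact (inv_le_comm₀ (ha_pos 0) hK0').1 h0
  have hℓ0 : 0 < ε * q := by positivity
  have hℓ : ε * q ≤ min ρ 1 := le_trans (by gcongr) hεQ
  obtain ⟨g, hg, hfg, hD⟩ := hf.exists_locallyAC
  rw [lintegral_congr_ae (hfg.mono fun x hx => by simp only [hx] :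
      (fun x => ‖f x‖ₑ) =ᵐ[mu a] fun x => ‖g x‖ₑ),
    lintegral_congr_ae (hfg.mono fun x hx => by simp only [hx] :
      (fun x => ‖f x‖ₑ ^ 2) =ᵐ[mu a] fun x => ‖g x‖ₑ ^ 2)]
  have main := hg.lintegral_sq_le_of_density ha hℓ0 ((hℓ.trans (min_le_left _ _)).trans hρR) hk0
    hc0 hkK hdecay
  refine main.trans (add_le_add ?_ ?_)
  · rw [hD, ← mul_assoc, ← ENNReal.ofReal_ofNat 2, ← ENNReal.ofReal_mul (by positivity)]
    gcongr
    have h1 : K * (ε * q) ^ 2 ≤ r / 36 := by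
      calc K * (ε * q) ^ 2 = ε ^ 2 * r := by rw [mul_pow, hq2]; field_simp
        _ ≤ (1 / 6) ^ 2 * r := by gcongr
        _ = _ := by ring
    have h2 : 192 * c ≤ r := by
      rw [hc, mul_div_assoc', div_le_iff₀ hC₂0, hC₂]
      nlinarith
    have h3 : c * (ε * q) ≤ c * 1 := by gcongr; exact hℓ.trans (min_le_right _ _)
    linarith
  · gcongr
    have hK0r : K0 a T = ENNReal.ofReal (K ^ (3 / 2 : ℝ) / k ^ 2) := by
      rw [K0, ← ENNReal.ofReal_toReal hKtop, ← ENNReal.ofReal_toReal (smallK_ne_top a T),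
        ENNReal.ofReal_rpow_of_nonneg hK0'.le (by norm_num), ← ENNReal.ofReal_pow hk0.le,
        ← ENNReal.ofReal_div_of_pos (by positivity)]
    have hpow : r ^ (-(1 / 2) : ℝ) * K ^ (3 / 2 : ℝ) = K / q := by
      rw [hq, Real.sqrt_eq_rpow, Real.div_rpow hr.le hK0'.le, Real.rpow_neg hr.le,
        show (3 / 2 : ℝ) = 1 + 1 / 2 by norm_num, Real.rpow_add hK0', Real.rpow_one]
      field_simp
    have hreal : (4 * K / (ε * q) + 8 * c / (ε * q) ^ 2) / k ^ 2 ≤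
        C₁ * (r ^ (-(1 / 2) : ℝ) * (K ^ (3 / 2 : ℝ) / k ^ 2)) := by
      rw [← mul_div_assoc (r ^ _), hpow, ← mul_div_assoc C₁]
      gcongr
      have h1 : 8 * c / (ε * q) ^ 2 ≤ Q / ε ^ 2 * (K / q) := by
        have h2 : 8 * c ≤ r := by
          rw [hc, mul_div_assoc', div_le_iff₀ hC₂0, hC₂]
          nlinarith
        calc 8 * c / (ε * q) ^ 2 ≤ r / (ε * q) ^ 2 := by gcongr
          _ = q / ε ^ 2 * (K / q) := by rw [mul_pow, hq2]; field_simp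
          _ ≤ _ := by gcongr
      have h3 : 4 * K / (ε * q) = 4 / ε * (K / q) := by field_simp
      have h4 : 0 < K / q := by positivity
      rw [h3, hC₁]
      nlinarith
    rw [superRate, ← hT, hK0r, ← ENNReal.ofReal_mul (by positivity)]
    refine (ENNReal.ofReal_le_ofReal hreal).trans ?_
    rw [ENNReal.ofReal_mul hC₁0.le]
    gcongr
    exact le_add_self

/-! ### The weak Poincaré inequality -/

/-- Comparison of the second moment of a centred bounded function with its oscillation on a set of
large probability. -/
lemma lintegral_sq_le_of_mean_zero {α : Type*} [MeasurableSpace α] {ν : Measure α}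
    [IsProbabilityMeasure ν] {f : α → ℝ} (hf : MemLp f 2 ν) (hmean : ∫ x, f x ∂ν = 0) {N : ℝ}
    (hN : ∀ᵐ x ∂ν, |f x| ≤ N) {S : Set α} (hS : MeasurableSet S) {r : ℝ} (hr : 0 < r)
    (hp : 1 / (1 + r) ≤ ν.real S) (c : ℝ) :
    ∫⁻ x, ‖f x‖ₑ ^ 2 ∂ν ≤ ∫⁻ x in S, ‖f x - c‖ₑ ^ 2 ∂ν + ENNReal.ofReal (r * N ^ 2) := by
  set p := ν.real S with hpdef
  have hp0 : 0 < p := lt_of_lt_of_le (by positivity) hp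
  have hcompl : ν.real Sᶜ = 1 - p := by rw [probReal_compl_eq_one_sub hS]
  have hp1 : 0 ≤ 1 - p := hcompl ▸ measureReal_nonneg
  have hint : Integrable f ν := hf.integrable (by norm_num)
  set m := ∫ x in S, f x ∂ν with hm
  have hm2 : m ^ 2 ≤ (N * (1 - p)) ^ 2 := by
    have h1 : m = -∫ x in Sᶜ, f x ∂ν := by
      have := integral_add_compl hS hint
      linarith
    have h2 : ‖∫ x in Sᶜ, f x ∂ν‖ ≤ N * ν.real Sᶜ :=
      norm_setIntegral_le_of_norm_le_const_ae (measure_lt_top _ _)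
        (ae_restrict_of_ae (hN.mono fun x hx => hx))
    rw [h1, neg_sq, ← sq_abs, ← hcompl]
    exact pow_le_pow_left₀ (abs_nonneg _) h2 2
  have hout : ∫ x in Sᶜ, f x ^ 2 ∂ν ≤ N ^ 2 * (1 - p) := by
    have h2 : ‖∫ x in Sᶜ, f x ^ 2 ∂ν‖ ≤ N ^ 2 * ν.real Sᶜ := by
      refine norm_setIntegral_le_of_norm_le_const_ae (measure_lt_top _ _)
        (ae_restrict_of_ae (hN.mono fun x hx => ?_))
      rw [norm_pow]
      exact pow_le_pow_left₀ (norm_nonneg _) hx 2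
    rw [← hcompl]
    exact (le_abs_self _).trans h2
  have hsum := integral_add_compl hS hf.integrable_sq
  rw [lintegral_enorm_sq hf, lintegral_sub_const_sq (hf.restrict S)]
  refine (ENNReal.ofReal_le_ofReal ?_).trans ENNReal.ofReal_add_le
  rw [measureReal_restrict_apply_univ, ← hpdef, ← hm, ← hsum]
  -- Completing the square in `c`: replacing `f` by `f - c` on `S` loses at most `m² / p`. With the
  -- part outside `S` the total loss is at most `N² (1-p)²/p + N² (1-p) = N² (1-p)/p ≤ r N²`.
  have h1 : 0 ≤ (c * p - m) ^ 2 / p := by positivity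
  have h2 : (c * p - m) ^ 2 / p = c ^ 2 * p - 2 * c * m + m ^ 2 / p := by field_simp; ring
  have h3 : m ^ 2 / p ≤ (N * (1 - p)) ^ 2 / p := by gcongr
  have h4 : (N * (1 - p)) ^ 2 / p + N ^ 2 * (1 - p) = N ^ 2 * ((1 - p) / p) := by
    field_simp; ring
  have h5 : (1 - p) / p ≤ r := by
    rw [div_le_iff₀ hp0]
    rw [div_le_iff₀ (by positivity)] at hp
    linarith
  have h6 : N ^ 2 * ((1 - p) / p) ≤ N ^ 2 * r := by gcongr
  linarith

/-- The constant is `8 · 2 · 2`: from `hardy`, from the tail bound `2 / Φ₀(s)`, and from `∫ g'² = 2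
𝓔`. -/
lemma weakPoincare_weakRate {a : ℝ → ℝ} (ha_pos : ∀ x, 0 < a x) [IsProbabilityMeasure (mu a)] :
    WeakPoincare a (weakRate a 32) := by
  intro r hr f hf hmean
  rcases eq_or_ne (eLpNorm f ∞ (mu a)) ∞ with htop | htop
  · rw [htop, ENNReal.top_pow two_ne_zero, ENNReal.mul_top (ENNReal.ofReal_pos.2 hr).ne', add_top]
    exact le_top
  obtain ⟨g, hg, hfg, hD⟩ := hf.exists_locallyAC
  set N := (eLpNorm f ∞ (mu a)).toReal with hN
  have hbound : ∀ᵐ x ∂(mu a), |f x| ≤ N := by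
    filter_upwards [enorm_ae_le_eLpNormEssSup f (mu a)] with x hx
    rw [← eLpNorm_exponent_top, Real.enorm_eq_ofReal_abs] at hx
    exact (ENNReal.ofReal_le_iff_le_toReal htop).1 hx
  have hX : ENNReal.ofReal r * eLpNorm f ∞ (mu a) ^ 2 = ENNReal.ofReal (r * N ^ 2) := by
    rw [ENNReal.ofReal_mul hr.le, ENNReal.ofReal_pow ENNReal.toReal_nonneg,
      ENNReal.ofReal_toReal htop]
  rw [hX]
  set X := ENNReal.ofReal (r * N ^ 2)
  have key (s : ℝ≥0) (hs : ENNReal.ofReal (1 / (1 + r)) ≤ mu a (Metric.ball 0 s)) :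
      ∫⁻ x, ‖f x‖ₑ ^ 2 ∂(mu a) ≤ 32 * (Phi0 a s)⁻¹ * energy f + X := by
    refine (lintegral_sq_le_of_mean_zero hf.1 hmean hbound Metric.isOpen_ball.measurableSet hr
      ((ENNReal.ofReal_le_iff_le_toReal (measure_ne_top _ _)).1 hs) (g 0)).trans ?_
    gcongr
    have hden : ∀ x ∈ Metric.ball (0 : ℝ) s,
        ENNReal.ofReal (a x)⁻¹ ≤ (Phi0 a s)⁻¹ * ENNReal.ofReal (((1 + |x|) ^ 2)⁻¹) := by
      intro x hx
      refine ofReal_inv_le_of_le (ha_pos x) (iInf₂_le x ?_)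
      rw [Real.enorm_eq_ofReal_abs, ← ENNReal.ofReal_coe_nnreal]
      exact ENNReal.ofReal_le_ofReal (by simpa using (Metric.mem_ball.1 hx).le)
    calc _ = ∫⁻ x in Metric.ball 0 s, ‖g x - g 0‖ₑ ^ 2 ∂(mu a) :=
          lintegral_congr_ae (ae_restrict_of_ae (hfg.mono fun x hx => by simp only [hx]))
      _ ≤ ∫⁻ x in Metric.ball 0 s,
          (∫⁻ t in {t : ℝ | |t| ≤ |x|}, ‖deriv g t‖ₑ) ^ 2 ∂(mu a) := by
          gcongr with x
          exact hg.enorm_sub_zero_le x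
      _ ≤ _ := hardy (enorm_mul_restrict_tail_le Metric.isOpen_ball.measurableSet hden)
          (measurable_enorm_deriv g)
      _ = _ := by rw [hD]; ring
  obtain ⟨s₀, hs₀, hs₀'⟩ : ∃ s : ℝ≥0, 0 < s ∧
      ENNReal.ofReal (1 / (1 + r)) ≤ mu a (Metric.ball 0 s) := by
    obtain ⟨R, hR, hRε⟩ := exists_tail_measure_le (ν := mu a)
      (ENNReal.ofReal_pos.2 (show 0 < r / (1 + r) by positivity))
    refine ⟨⟨R, hR.le⟩, hR, ?_⟩
    have hball : {s : ℝ | R ≤ |s|} = (Metric.ball (0 : ℝ) R)ᶜ := by ext s; simp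
    rw [hball] at hRε
    have h1 := prob_add_prob_compl (μ := mu a) (s := Metric.ball (0 : ℝ) R)
      Metric.isOpen_ball.measurableSet
    have h2 : ENNReal.ofReal (1 / (1 + r)) + ENNReal.ofReal (r / (1 + r)) = 1 := by
      rw [← ENNReal.ofReal_add (by positivity) (by positivity), ← add_div, div_self (by positivity),
        ENNReal.ofReal_one]
    rw [← ENNReal.add_le_add_iff_right (ENNReal.ofReal_ne_top (r := r / (1 + r))), h2, ← h1]
    exact add_le_add_right hRε _
  rw [weakRate, ENNReal.ofReal_ofNat]
  -- The infimum over `s` is reached by dividing by `32 * energy f`, which must be nonzero. At zero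
  -- energy a single admissible `s₀` suffices, since `∞ * 0 = 0`.
  rcases eq_or_ne (energy f) 0 with hE | hE
  · simpa [hE] using key s₀ hs₀'
  · have hE0 : 32 * energy f ≠ 0 := mul_ne_zero (by norm_num) hE
    have hEt : 32 * energy f ≠ ∞ := ENNReal.mul_ne_top (by norm_num) hf.2.ne
    rw [mul_right_comm, mul_comm (32 * energy f), ← tsub_le_iff_right,
      ← ENNReal.div_le_iff_le_mul (Or.inl hE0) (Or.inl hEt)]
    refine le_iInf₂ fun s hs => ?_
    rw [ENNReal.div_le_iff_le_mul (Or.inl hE0) (Or.inl hEt), tsub_le_iff_right]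
    refine (key s hs.2).trans_eq ?_
    ring

end TimeChangedBM

/-! ### Assembly of the three equivalences and rates -/

theorem theorem4p1 (a : ℝ → ℝ) (ha_meas : Measurable a) (ha_pos : ∀ x, 0 < a x)
    (ha_bdd : ∀ R : ℝ, ∃ M : ℝ, ∀ x : ℝ, |x| ≤ R → a x ≤ M)
    (ha_prob : ∫⁻ x, ENNReal.ofReal (a x)⁻¹ = 1) :
    -- Poincaré inequality
    (((∃ C : ℝ, 0 < C ∧ TimeChangedBM.Poincare a C) ↔ TimeChangedBM.tailLimsup a < ∞) ∧
      (∀ L : ℝ≥0∞, Tendsto (fun r : ℝ≥0 => TimeChangedBM.Phi a r) atTop (𝓝 L) → 0 < L →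
        TimeChangedBM.tailLimsup a < ∞)) ∧
    -- super Poincaré inequality
    (((∃ β : ℝ → ℝ, (∀ r, 0 < r → 0 < β r) ∧
          TimeChangedBM.SuperPoincare a (fun r => ENNReal.ofReal (β r))) ↔
        TimeChangedBM.tailLimsup a = 0) ∧
      (TimeChangedBM.tailLimsup a = 0 →
        ∃ C₁ C₂ : ℝ, 0 < C₁ ∧ 0 < C₂ ∧
          TimeChangedBM.SuperPoincare a (TimeChangedBM.superRate a C₁ C₂)) ∧
      (Tendsto (fun r : ℝ≥0 => TimeChangedBM.Phi a r) atTop (𝓝 ∞) →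
        TimeChangedBM.tailLimsup a = 0)) ∧
    -- weak Poincaré inequality
    (Tendsto (fun r : ℝ≥0 => TimeChangedBM.Phi0 a r) atTop (𝓝 0) →
      ∃ C : ℝ, 0 < C ∧ TimeChangedBM.WeakPoincare a (TimeChangedBM.weakRate a C)) := by
  have hprob := TimeChangedBM.isProbabilityMeasure_mu ha_prob
  have hpoin : TimeChangedBM.tailLimsup a < ∞ → ∃ C : ℝ, 0 < C ∧ TimeChangedBM.Poincare a C := by
    intro h
    obtain ⟨B, hB0, hB⟩ := TimeChangedBM.exists_tail_bound h
    exact ⟨16 * B, by positivity, TimeChangedBM.poincare_of_tail_bound hB⟩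
  refine ⟨⟨⟨?_, hpoin⟩, ?_⟩, ⟨⟨?_, TimeChangedBM.exists_superPoincare ha_meas ha_pos ha_bdd⟩,
    ?_, ?_⟩, fun _ => ⟨32, by norm_num, TimeChangedBM.weakPoincare_weakRate ha_pos⟩⟩
  · rintro ⟨C, -, hC⟩
    refine (TimeChangedBM.tailLimsup_le_of_defective_poincare (r := ENNReal.ofReal C)
      ENNReal.one_ne_top fun f hf => ?_).trans_lt (by finiteness)
    simpa using hC.lintegral_sq_le hf
  · intro L hL hL0
    obtain ⟨c, hc0, hcL⟩ := exists_between hL0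
    obtain ⟨r, hr⟩ := (hL.eventually_const_lt hcL).exists
    refine (TimeChangedBM.tailLimsup_le_of_le_Phi ha_pos hr.le).trans_lt ?_
    exact ENNReal.mul_lt_top (by simp) (ENNReal.inv_lt_top.2 hc0)
  · rintro ⟨β, -, hβ⟩
    have h (r : ℝ) (hr : 0 < r) : TimeChangedBM.tailLimsup a ≤ 4 * ENNReal.ofReal r :=
      TimeChangedBM.tailLimsup_le_of_defective_poincare ENNReal.ofReal_ne_top (hβ r hr)
    have hlim : Tendsto (fun r : ℝ => 4 * ENNReal.ofReal r) (𝓝[>] 0) (𝓝 0) := by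
      have hc : Continuous fun r : ℝ => 4 * ENNReal.ofReal r :=
        (ENNReal.continuous_const_mul (by simp)).comp ENNReal.continuous_ofReal
      simpa using (hc.tendsto 0).mono_left (nhdsWithin_le_nhds (s := Set.Ioi 0))
    exact nonpos_iff_eq_zero.1 (ge_of_tendsto hlim (eventually_mem_nhdsWithin.mono h))
  · intro h
    obtain ⟨C, hC0, hC⟩ := hpoin (by simp [h])
    exact TimeChangedBM.exists_superPoincare_superRate ha_meas ha_pos ha_bdd hC0 hC
  · intro hL
    have h (n : ℕ) : TimeChangedBM.tailLimsup a ≤ 2 * (n : ℝ≥0∞)⁻¹ := by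
      obtain ⟨r, hr⟩ := (hL.eventually_const_lt (ENNReal.natCast_lt_top n)).exists
      exact TimeChangedBM.tailLimsup_le_of_le_Phi ha_pos hr.le
    have hlim : Tendsto (fun n : ℕ => 2 * (n : ℝ≥0∞)⁻¹) atTop (𝓝 0) := by
      simpa using ENNReal.Tendsto.const_mul ENNReal.tendsto_inv_nat_nhds_zero
        (Or.inr (ENNReal.ofNat_ne_top (n := 2)))
    exact nonpos_iff_eq_zero.1 (ge_of_tendsto' hlim h)
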